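/- Let $\eta\in[0,1]$ and let $\mathcal A$ be the qubit amplitude damping channel of transmissivity $\eta$, i.e. $\mathcal A(\rho)=K_0\rho K_0^\dagger+K_1\rho K_1^\dagger$ with $K_0=|1\rangle\langle 1|+\sqrt{\eta}\,|0\rangle\langle 0|$ and $K_1=\sqrt{1-\eta}\,|1\rangle\langle 0|$. For a finite ensemble $\{p_X(x),|\phi^x\rangle_{AA'}\}$ of pure states, where $A'$ is a qubit and $A$ is a finite-dimensional reference system, put $$\rho_{XAB}=\sum_x p_X(x)\,|x\rangle\langle x|_X\otimes(\mathrm{id}_A\otimes\mathcal A_{A'\to B})(|\phi^x\rangle\langle\phi^x|_{AA'}),$$ and let $I(A\rangle BX)_\rho=H(BX)_\rho-H(ABX)_\rho$ and $I(X;B)_\rho=H(X)_\rho+H(B)_\rho-H(BX)_\rho$, where $H(\cdot)_\rho$ denotes the von Neumann entropy (logarithm to base 2) of the corresponding marginal of $\rho_{XAB}$. The single-letter classical–quantum trade-off region of $\mathcal A$ is the set of all pairs $(C,Q)\in\mathbb R^2$ for which there is such an ensemble with $$Q\le I(A\rangle BX)_\rho,\qquad C+Q\le I(X;B)_\rho+I(A\rangle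 BX)_\rho .$$ This region is equal to the union, over all $p_0,q_0,q_1,\nu_0,\nu_1\in[0,1]$, with $p_1=1-p_0$ and $p=\sum_{x\in\{0,1\}}p_xq_x$, of the polyhedra of all $(C,Q)\in\mathbb R^2$ with $$Q\le\sum_{x\in\{0,1\}}p_x\,[g(q_x,\eta,\nu_x)-g(q_x,1-\eta,\nu_x)],\qquad C+Q\le h_2(\eta p)-\sum_{x\in\{0,1\}}p_x\,g(q_x,1-\eta,\nu_x),$$ where $$g(q,z,\nu)=h_2\!\left(\frac{1+\sqrt{(1-2zq)^2+4z\nu^2q(1-q)}}{2}\right),\qquad h_2(y)=-y\log_2y-(1-y)\log_2(1-y),\quad 0\log_2 0=0.$$ -/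

import Mathlib

open scoped Matrix Kronecker

namespace AmplitudeDamping

noncomputable section

/-- Binary Shannon entropy in bits, `h₂(y) = -y log₂ y - (1-y) log₂ (1-y)`
(`Real.logb 2 0 = 0` gives the convention `0 log 0 = 0`). -/
def h2 (y : ℝ) : ℝ := -y * Real.logb 2 y - (1 - y) * Real.logb 2 (1 - y)

/-- `g(q,z,ν) = h₂((1 + √((1 - 2zq)² + 4zν²q(1-q))) / 2)`. -/
def g (q z ν : ℝ) : ℝ :=
  h2 ((1 + Real.sqrt ((1 - 2 * z * q) ^ 2 + 4 * z * ν ^ 2 * q * (1 - q))) / 2)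

/-- Von Neumann entropy in bits, `-Tr(ρ log₂ ρ)`, by functional calculus of the Hermitian
matrix `ρ`. -/
def vnEntropy {ι : Type*} [Fintype ι] [DecidableEq ι] (ρ : Matrix ι ι ℂ) : ℝ :=
  (Matrix.trace (cfc (fun t : ℝ => -(t * Real.logb 2 t)) ρ)).re

/-- Partial trace over the first tensor factor. -/
def traceFst {ι κ : Type*} [Fintype ι] (M : Matrix (ι × κ) (ι × κ) ℂ) : Matrix κ κ ℂ :=
  Matrix.of fun b b' => ∑ a, M (a, b) (a, b')

/-- Partial trace over the second tensor factor. -/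
def traceSnd {ι κ : Type*} [Fintype κ] (M : Matrix (ι × κ) (ι × κ) ℂ) : Matrix ι ι ℂ :=
  Matrix.of fun a a' => ∑ b, M (a, b) (a', b)

/-- Partial trace over the middle one of three tensor factors. -/
def traceMid {ι κ τ : Type*} [Fintype κ]
    (M : Matrix (ι × κ × τ) (ι × κ × τ) ℂ) : Matrix (ι × τ) (ι × τ) ℂ :=
  Matrix.of fun a a' => ∑ b, M (a.1, b, a.2) (a'.1, b, a'.2)

/-- Kraus operators of the qubit amplitude damping channel of transmissivity `η`, in the basis
`|0⟩, |1⟩`: `K₀ = |1⟩⟨1| + √η |0⟩⟨0|` and `K₁ = √(1-η) |1⟩⟨0|`. -/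
def kraus (η : ℝ) : Fin 2 → Matrix (Fin 2) (Fin 2) ℂ :=
  ![!![(Real.sqrt η : ℂ), 0; 0, 1], !![0, 0; (Real.sqrt (1 - η) : ℂ), 0]]

/-- The channel acting on the second factor of `A ⊗ A'`: `M ↦ ∑ⱼ (1 ⊗ Kⱼ) M (1 ⊗ Kⱼ)†`. -/
def dampSnd {α : Type*} [Fintype α] [DecidableEq α] (η : ℝ)
    (M : Matrix (α × Fin 2) (α × Fin 2) ℂ) : Matrix (α × Fin 2) (α × Fin 2) ℂ :=
  ∑ j, ((1 : Matrix α α ℂ) ⊗ₖ kraus η j) * M * ((1 : Matrix α α ℂ) ⊗ₖ kraus η j)ᴴ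

/-- A finite ensemble `{p_X(x), |φˣ⟩_{AA'}}` of pure bipartite states, with `A'` a qubit, over an
alphabet of `n` letters and with a reference system `A` of dimension `d`. -/
structure Ensemble (n d : ℕ) where
  /-- the letter distribution -/
  prob : Fin n → ℝ
  prob_nonneg : ∀ x, 0 ≤ prob x
  prob_sum : ∑ x, prob x = 1
  /-- the state vector of each letter -/
  vec : Fin n → Fin d × Fin 2 → ℂ
  vec_norm : ∀ x, ∑ i, ‖vec x i‖ ^ 2 = 1

namespace Ensemble

variable {n d : ℕ}

/-- `ρ_{XAB} = ∑ₓ p_X(x) |x⟩⟨x|_X ⊗ (id_A ⊗ 𝒜)(|φˣ⟩⟨φˣ|_{AA'})`. -/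
def stateXAB (η : ℝ) (e : Ensemble n d) :
    Matrix (Fin n × Fin d × Fin 2) (Fin n × Fin d × Fin 2) ℂ :=
  ∑ x, (e.prob x : ℂ) •
    (Matrix.single x x (1 : ℂ) ⊗ₖ
      dampSnd η (Matrix.vecMulVec (e.vec x) (star (e.vec x))))

/-- `ρ_{XB}`. -/
def stateXB (η : ℝ) (e : Ensemble n d) : Matrix (Fin n × Fin 2) (Fin n × Fin 2) ℂ :=
  traceMid (e.stateXAB η)

/-- `ρ_X`. -/
def stateX (η : ℝ) (e : Ensemble n d) : Matrix (Fin n) (Fin n) ℂ :=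
  traceSnd (e.stateXB η)

/-- `ρ_B`. -/
def stateB (η : ℝ) (e : Ensemble n d) : Matrix (Fin 2) (Fin 2) ℂ :=
  traceFst (e.stateXB η)

/-- Coherent information `I(A⟩BX) = H(BX) - H(ABX)`. -/
def coherentInfo (η : ℝ) (e : Ensemble n d) : ℝ :=
  vnEntropy (e.stateXB η) - vnEntropy (e.stateXAB η)

/-- Holevo information `I(X;B) = H(X) + H(B) - H(BX)`. -/
def holevoInfo (η : ℝ) (e : Ensemble n d) : ℝ :=
  vnEntropy (e.stateX η) + vnEntropy (e.stateB η) - vnEntropy (e.stateXB η)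

end Ensemble

/-- The polyhedron of rate pairs `(C, Q)` with `Q ≤ a` and `C + Q ≤ b`. -/
def ratePolyhedron (a b : ℝ) : Set (ℝ × ℝ) := {r | r.2 ≤ a ∧ r.1 + r.2 ≤ b}

/-- The single-letter classical-quantum trade-off region of the amplitude damping channel: the
union, over all ensembles, of `Q ≤ I(A⟩BX)`, `C + Q ≤ I(X;B) + I(A⟩BX)`. -/
def tradeoffRegion (η : ℝ) : Set (ℝ × ℝ) :=
  ⋃ (n : ℕ) (d : ℕ) (e : Ensemble n d),
    ratePolyhedron (e.coherentInfo η) (e.holevoInfo η + e.coherentInfo η)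

end

end AmplitudeDamping

/-! A letter enters only through the population `q` and coherence `c` of its reduced qubit. With `m
= q - |c|²`, so that `q² ≤ m ≤ q`, the channel output has determinant `η(m - ηq²)` and the
environment output `(1-η)(m - (1-η)q²)`. A qubit entropy is a function `H` (`detEntropy`) of the
determinant. The entropy of `ABX` is obtained from the environment blocks, because `W Wᴴ` and `Wᴴ W`
have the same nonzero spectrum; this removes the dimension of the reference. With `m = q -
ν²q(1-q)`, the function `g` is exactly this `H` in bits (`g_eq`).

For one inclusion, a single letter with the mean population already dominates any ensemble
(`exists_dominating_letter`): its coherent information is at least the average, its environment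
entropy at most the average. For `η ≤ 1/2` a letter with pure reduced qubit works, by convexity of
entropy in the concurrence. For `1/2 < η < 1` the point is that the output entropy is jointly
concave in the population and the environment entropy (`concaveOn_detEntropy_outputDet`). Its second
derivative along segments is controlled by two facts about `A = -H''/H'`: `D A(D)` increases with
`D`, and `2 D A(D) ≤ 1`. Both are inequalities for `artanh`. Finally, dropping the coherence of the
mean output only raises the entropy of `B`.

For the other inclusion, each of the two letters is sent with both signs of its coherence. The
letterwise entropies do not change, while the mean coherence cancels, so that `B` has entropy
`h₂(ηp)`. -/

namespace AmplitudeDamping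

open Set

/-! ### Inequalities for `artanh` and the elasticity of the qubit entropy. -/

/-- The inverse hyperbolic tangent `(log (1 + r) - log (1 - r)) / 2`. -/
noncomputable def atanh (r : ℝ) : ℝ := (Real.log (1 + r) - Real.log (1 - r)) / 2

lemma hasDerivAt_atanh {r : ℝ} (h0 : -1 < r) (h1 : r < 1) :
    HasDerivAt atanh (1 / (1 - r ^ 2)) r := by
  have ha : 1 + r ≠ 0 := by linarith
  have hb : 1 - r ≠ 0 := by linarith
  have hc : 1 - r ^ 2 ≠ 0 := by
    have : 1 - r ^ 2 = (1 + r) * (1 - r) := by ring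
    rw [this]; exact mul_ne_zero ha hb
  have h := ((((hasDerivAt_id r).const_add 1).log ha).sub
    (((hasDerivAt_id r).const_sub 1).log hb)).div_const 2
  refine h.congr_deriv ?_
  simp only [id]
  field_simp
  ring

lemma atanh_zero : atanh 0 = 0 := by simp [atanh]

/-- A function vanishing at `0` with nonnegative derivative on `(0, 1)` is nonnegative there. -/
lemma nonneg_of_deriv_nonneg {f f' : ℝ → ℝ} (h0 : 0 ≤ f 0)
    (hf : ∀ x ∈ Ico (0 : ℝ) 1, HasDerivAt f (f' x) x)
    (hf' : ∀ x ∈ Ioo (0 : ℝ) 1, 0 ≤ f' x) {r : ℝ} (hr : r ∈ Ico (0 : ℝ) 1) : 0 ≤ f r := by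
  have hmono : MonotoneOn f (Ico (0 : ℝ) 1) := by
    refine monotoneOn_of_deriv_nonneg (convex_Ico 0 1)
      (fun x hx => (hf x hx).continuousAt.continuousWithinAt) ?_ ?_
    · intro x hx
      rw [interior_Ico] at hx
      exact (hf x ⟨hx.1.le, hx.2⟩).differentiableAt.differentiableWithinAt
    · intro x hx
      rw [interior_Ico] at hx
      rw [(hf x ⟨hx.1.le, hx.2⟩).deriv]
      exact hf' x hx
  exact h0.trans (hmono ⟨le_rfl, one_pos⟩ hr hr.1)

lemma one_sub_sq_pos {x : ℝ} (hx : x ∈ Ico (0 : ℝ) 1) : 0 < 1 - x ^ 2 := by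
  nlinarith [hx.1, hx.2]

lemma le_atanh {r : ℝ} (hr : r ∈ Ico (0 : ℝ) 1) : r ≤ atanh r := by
  have := nonneg_of_deriv_nonneg (f := fun x => atanh x - x)
    (f' := fun x => 1 / (1 - x ^ 2) - 1) (by simp [atanh_zero])
    (fun x hx => (hasDerivAt_atanh (by linarith [hx.1]) hx.2).sub (hasDerivAt_id x))
    (fun x hx => by
      have h := one_sub_sq_pos (Ioo_subset_Ico_self hx)
      rw [sub_nonneg, le_div_iff₀ h]
      nlinarith [sq_nonneg x]) hr
  simpa using this

lemma atanh_pos {r : ℝ} (hr : r ∈ Ioo (0 : ℝ) 1) : 0 < atanh r :=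
  hr.1.trans_le (le_atanh (Ioo_subset_Ico_self hr))

/-- The bound agrees with `artanh` to third order at `0`, and the gap has the manifestly nonnegative
derivative `f'`. It is the form needed to sign the derivative in `two_mul_atanh_sq_le`. -/
lemma atanh_le_rational {r : ℝ} (hr : r ∈ Ico (0 : ℝ) 1) :
    atanh r ≤ r * (3 - r ^ 2) / ((1 - r ^ 2) * (3 + r ^ 2)) := by
  have := nonneg_of_deriv_nonneg
    (f := fun x => x * (3 - x ^ 2) / ((1 - x ^ 2) * (3 + x ^ 2)) - atanh x)
    (f' := fun x => 16 * x ^ 4 / ((1 - x ^ 2) * (3 + x ^ 2)) ^ 2) (by simp [atanh_zero])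
    (fun x hx => by
      have h := one_sub_sq_pos hx
      have h3 : 0 < 3 + x ^ 2 := by positivity
      have hP : (1 - x ^ 2) * (3 + x ^ 2) ≠ 0 := (mul_pos h h3).ne'
      have hx2 : HasDerivAt (fun y : ℝ => y ^ 2) (2 * x) x := by
        simpa using hasDerivAt_pow 2 x
      have hN := (hasDerivAt_id x).mul (hx2.const_sub 3)
      have hD := (hx2.const_sub 1).mul (hx2.const_add 3)
      refine ((hN.div hD hP).sub (hasDerivAt_atanh (by linarith [hx.1]) hx.2)).congr_deriv ?_
      simp only [id, Pi.mul_apply]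
      field_simp
      ring)
    (fun x hx => by positivity) hr
  simpa using this

/-- The derivative of the gap is a positive multiple of the gap in `atanh_le_rational`. This gap is,
up to sign, the numerator of the derivative of `elasticity`. -/
lemma two_mul_atanh_sq_le {r : ℝ} (hr : r ∈ Ico (0 : ℝ) 1) :
    2 * atanh r ^ 2 ≤ r * atanh r + r ^ 2 / (1 - r ^ 2) := by
  have := nonneg_of_deriv_nonneg
    (f := fun x => x * atanh x + x ^ 2 / (1 - x ^ 2) - 2 * atanh x ^ 2)
    (f' := fun x => (3 + x ^ 2) / (1 - x ^ 2) *
      (x * (3 - x ^ 2) / ((1 - x ^ 2) * (3 + x ^ 2)) - atanh x)) (by simp [atanh_zero])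
    (fun x hx => by
      have h := one_sub_sq_pos hx
      have h3 : 0 < 3 + x ^ 2 := by positivity
      have hx2 : HasDerivAt (fun y : ℝ => y ^ 2) (2 * x) x := by
        simpa using hasDerivAt_pow 2 x
      have hL := hasDerivAt_atanh (by linarith [hx.1]) hx.2
      refine ((((hasDerivAt_id x).mul hL).add (hx2.div (hx2.const_sub 1) h.ne')).sub
        ((hL.pow 2).const_mul 2)).congr_deriv ?_
      simp only [id]
      field_simp
      ring)
    (fun x hx => by
      have hx' := Ioo_subset_Ico_self hx
      have h := one_sub_sq_pos hx'
      have := atanh_le_rational hx'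
      exact mul_nonneg (by positivity) (by linarith)) hr
  linarith

/-- `r ↦ 1 / (r artanh r) - (1 - r²) / r²`, twice the elasticity `-v H''(v) / H'(v)` of the qubit
entropy `H` as a function of the determinant `v = (1 - r²) / 4`. -/
noncomputable def elasticity (r : ℝ) : ℝ := 1 / (r * atanh r) - (1 - r ^ 2) / r ^ 2

lemma elasticity_le_one {r : ℝ} (hr : r ∈ Ioo (0 : ℝ) 1) : elasticity r ≤ 1 := by
  have hL := atanh_pos hr
  have h := le_atanh (Ioo_subset_Ico_self hr)
  have h0 := hr.1
  have : elasticity r = 1 - (atanh r - r) / (r ^ 2 * atanh r) := by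
    unfold elasticity; field_simp; ring
  rw [this]
  have : 0 ≤ (atanh r - r) / (r ^ 2 * atanh r) := div_nonneg (by linarith) (by positivity)
  linarith

lemma atanh_lt {r : ℝ} (hr : r ∈ Ioo (0 : ℝ) 1) : atanh r < r / (1 - r ^ 2) := by
  have h := one_sub_sq_pos (Ioo_subset_Ico_self hr)
  have h0 := hr.1
  refine (atanh_le_rational (Ioo_subset_Ico_self hr)).trans_lt ?_
  rw [div_lt_div_iff₀ (by positivity) h]
  nlinarith [mul_pos (mul_pos h0 h) (mul_pos h0 h0)]

lemma elasticity_pos {r : ℝ} (hr : r ∈ Ioo (0 : ℝ) 1) : 0 < elasticity r := by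
  have hL := atanh_pos hr
  have h := one_sub_sq_pos (Ioo_subset_Ico_self hr)
  have h2 := atanh_lt hr
  have h0 := hr.1
  rw [lt_div_iff₀ h] at h2
  have : elasticity r = (r - atanh r * (1 - r ^ 2)) / (r ^ 2 * atanh r) := by
    unfold elasticity; field_simp
  rw [this]
  exact div_pos (by linarith) (by positivity)

lemma antitoneOn_elasticity : AntitoneOn elasticity (Ioo 0 1) := by
  have hd : ∀ x ∈ Ioo (0 : ℝ) 1, HasDerivAt elasticity
      ((2 * atanh x ^ 2 - x * atanh x - x ^ 2 / (1 - x ^ 2)) / (x ^ 3 * atanh x ^ 2)) x := by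
    intro x hx
    have hL := atanh_pos hx
    have h := one_sub_sq_pos (Ioo_subset_Ico_self hx)
    have h0 := hx.1
    have hx2 : HasDerivAt (fun y : ℝ => y ^ 2) (2 * x) x := by
      simpa using hasDerivAt_pow 2 x
    have hLd := hasDerivAt_atanh (by linarith [hx.1]) hx.2
    have h1 := (hasDerivAt_const x (1 : ℝ)).div ((hasDerivAt_id x).mul hLd)
      (by simp only [Pi.mul_apply, id]; positivity)
    have h2 := (hx2.const_sub 1).div hx2 (by positivity)
    refine (h1.sub h2).congr_deriv ?_
    simp only [id, Pi.mul_apply]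
    field_simp
    ring
  refine antitoneOn_of_deriv_nonpos (convex_Ioo 0 1)
    (fun x hx => (hd x hx).continuousAt.continuousWithinAt) ?_ ?_
  · intro x hx
    rw [interior_Ioo] at hx
    exact (hd x hx).differentiableAt.differentiableWithinAt
  · intro x hx
    rw [interior_Ioo] at hx
    rw [(hd x hx).deriv]
    have h0 := hx.1
    exact div_nonpos_of_nonpos_of_nonneg
      (by linarith [two_mul_atanh_sq_le (Ioo_subset_Ico_self hx)]) (by positivity)

/-! ### Qubit entropy as a function of the determinant. -/

/-- Entropy in nats of a qubit state of determinant `D`. -/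
noncomputable def detEntropy (D : ℝ) : ℝ := Real.binEntropy ((1 + √(1 - 4 * D)) / 2)

/-- The derivative of `detEntropy`. -/
noncomputable def detEntropyDeriv (D : ℝ) : ℝ := 2 * atanh √(1 - 4 * D) / √(1 - 4 * D)

/-- The logarithmic derivative of `detEntropyDeriv`, up to sign. -/
noncomputable def detEntropyCurv (D : ℝ) : ℝ := elasticity √(1 - 4 * D) / (2 * D)

lemma detEntropy_mul_one_sub (x : ℝ) : detEntropy (x * (1 - x)) = Real.binEntropy x := by
  have h : 1 - 4 * (x * (1 - x)) = (1 - 2 * x) ^ 2 := by ring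
  rw [detEntropy, h, Real.sqrt_sq_eq_abs]
  rcases abs_cases (1 - 2 * x) with ⟨h, -⟩ | ⟨h, -⟩
  · rw [h, ← Real.binEntropy_one_sub]; congr 1; ring
  · rw [h]; congr 1; ring

lemma detEntropy_zero : detEntropy 0 = 0 := by
  simpa using detEntropy_mul_one_sub 0

lemma detEntropy_quarter : detEntropy (1 / 4) = Real.log 2 := by
  rw [← Real.binEntropy_two_inv, ← detEntropy_mul_one_sub]; norm_num

@[fun_prop]
lemma continuous_detEntropy : Continuous detEntropy := by
  unfold detEntropy; fun_prop

lemma strictMonoOn_detEntropy : StrictMonoOn detEntropy (Icc 0 (1 / 4)) := by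
  intro a ha b hb hab
  have h1 : √(1 - 4 * b) < √(1 - 4 * a) :=
    Real.sqrt_lt_sqrt (by linarith [hb.2]) (by linarith)
  have h2 : √(1 - 4 * a) ≤ 1 := Real.sqrt_le_one.mpr (by linarith [ha.1])
  have h3 := Real.sqrt_nonneg (1 - 4 * b)
  exact Real.binEntropy_strictAntiOn ⟨by norm_num; linarith, by linarith⟩
    ⟨by norm_num; linarith, by linarith⟩ (by linarith)

lemma sqrt_mem_Ioo {D : ℝ} (hD : D ∈ Ioo (0 : ℝ) (1 / 4)) : √(1 - 4 * D) ∈ Ioo (0 : ℝ) 1 :=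
  ⟨Real.sqrt_pos.mpr (by linarith [hD.2]), by
    rw [Real.sqrt_lt' one_pos]; linarith [hD.1]⟩

lemma hasDerivAt_sqrt_one_sub {D : ℝ} (hD : D < 1 / 4) :
    HasDerivAt (fun D : ℝ => √(1 - 4 * D)) (-2 / √(1 - 4 * D)) D := by
  have h : HasDerivAt (fun D : ℝ => 1 - 4 * D) (-4) D := by
    simpa using ((hasDerivAt_id D).const_mul 4).const_sub 1
  refine (h.sqrt (by linarith)).congr_deriv ?_
  have : 0 < √(1 - 4 * D) := Real.sqrt_pos.mpr (by linarith)
  field_simp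
  norm_num

lemma hasDerivAt_detEntropy {D : ℝ} (hD : D ∈ Ioo (0 : ℝ) (1 / 4)) :
    HasDerivAt detEntropy (detEntropyDeriv D) D := by
  obtain ⟨h0, h1⟩ := sqrt_mem_Ioo hD
  have hr := ((hasDerivAt_sqrt_one_sub hD.2).const_add 1).div_const 2
  have hb := Real.hasDerivAt_binEntropy (p := (1 + √(1 - 4 * D)) / 2) (by positivity)
    (by linarith)
  refine (hb.comp D hr).congr_deriv ?_
  have e1 : 1 - (1 + √(1 - 4 * D)) / 2 = (1 - √(1 - 4 * D)) / 2 := by ring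
  rw [e1, Real.log_div (by linarith) two_ne_zero, Real.log_div (by linarith) two_ne_zero,
    detEntropyDeriv, atanh]
  field_simp
  ring

lemma hasDerivAt_detEntropyDeriv {D : ℝ} (hD : D ∈ Ioo (0 : ℝ) (1 / 4)) :
    HasDerivAt detEntropyDeriv (-(detEntropyDeriv D * detEntropyCurv D)) D := by
  have hs := sqrt_mem_Ioo hD
  have hL := atanh_pos hs
  have hr := hasDerivAt_sqrt_one_sub hD.2
  have hA := (hasDerivAt_atanh (by linarith [hs.1]) hs.2).comp D hr
  refine ((hA.const_mul 2).div hr hs.1.ne').congr_deriv ?_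
  have hsq : √(1 - 4 * D) ^ 2 = 1 - 4 * D := Real.sq_sqrt (by linarith [hD.2])
  simp only [Function.comp_apply, detEntropyDeriv, detEntropyCurv, elasticity]
  -- Eliminating `D` in favour of `r` leaves an identity rational in `r` and `atanh r`.
  have hDe : D = (1 - √(1 - 4 * D) ^ 2) / 4 := by rw [hsq]; ring
  have hD0 := hD.1
  have h0 := hs.1
  generalize √(1 - 4 * D) = r at *
  have h1 : 0 < 1 - r ^ 2 := by linarith
  subst hDe
  field_simp
  ring

lemma detEntropyDeriv_pos {D : ℝ} (hD : D ∈ Ioo (0 : ℝ) (1 / 4)) : 0 < detEntropyDeriv D := by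
  have hs := sqrt_mem_Ioo hD
  exact div_pos (mul_pos two_pos (atanh_pos hs)) hs.1

lemma detEntropyCurv_pos {D : ℝ} (hD : D ∈ Ioo (0 : ℝ) (1 / 4)) : 0 < detEntropyCurv D :=
  div_pos (elasticity_pos (sqrt_mem_Ioo hD)) (by linarith [hD.1])

lemma two_mul_mul_detEntropyCurv {D : ℝ} (hD : D ∈ Ioo (0 : ℝ) (1 / 4)) :
    2 * D * detEntropyCurv D = elasticity √(1 - 4 * D) := by
  have := hD.1
  unfold detEntropyCurv
  field_simp

lemma two_mul_mul_detEntropyCurv_le_one {D : ℝ} (hD : D ∈ Ioo (0 : ℝ) (1 / 4)) :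
    2 * D * detEntropyCurv D ≤ 1 :=
  (two_mul_mul_detEntropyCurv hD).trans_le (elasticity_le_one (sqrt_mem_Ioo hD))

/-- Since `D ↦ √(1 - 4D)` reverses order, this is the antitonicity of `elasticity`. -/
lemma mul_detEntropyCurv_mono {D u : ℝ} (hD : D ∈ Ioo (0 : ℝ) (1 / 4))
    (hu : u ∈ Ioo (0 : ℝ) (1 / 4)) (h : D ≤ u) :
    D * detEntropyCurv D ≤ u * detEntropyCurv u := by
  have := antitoneOn_elasticity (sqrt_mem_Ioo hu) (sqrt_mem_Ioo hD)
    (Real.sqrt_le_sqrt (by linarith : 1 - 4 * u ≤ 1 - 4 * D))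
  rw [← two_mul_mul_detEntropyCurv hD, ← two_mul_mul_detEntropyCurv hu] at this
  linarith

/-- Entropy is a convex function of the concurrence. -/
lemma convexOn_detEntropy_mul_sq {C : ℝ} (h0 : 0 ≤ C) (h1 : C ≤ 1 / 4) :
    ConvexOn ℝ (Icc 0 1) fun q : ℝ => detEntropy (C * q ^ 2) := by
  -- For `C = 0` the determinant stays on the boundary, where the derivative formulas are not
  -- available.
  rcases h0.eq_or_lt with rfl | h0
  · simpa using convexOn_const _ (convex_Icc (0 : ℝ) 1)
  have hmem : ∀ q ∈ Ioo (0 : ℝ) 1, C * q ^ 2 ∈ Ioo (0 : ℝ) (1 / 4) := by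
    intro q hq
    have := hq.1
    have h2 : q ^ 2 < 1 := by nlinarith [hq.2]
    exact ⟨by positivity, by nlinarith⟩
  have hsq (q : ℝ) : HasDerivAt (fun q : ℝ => C * q ^ 2) (2 * C * q) q := by
    refine ((hasDerivAt_pow 2 q).const_mul C).congr_deriv ?_
    simp; ring
  refine convexOn_of_hasDerivWithinAt2_nonneg (convex_Icc 0 1) (by fun_prop)
    (f' := fun q => detEntropyDeriv (C * q ^ 2) * (2 * C * q))
    (f'' := fun q => -(detEntropyDeriv (C * q ^ 2) * detEntropyCurv (C * q ^ 2)) * (2 * C * q)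
      * (2 * C * q) + detEntropyDeriv (C * q ^ 2) * (2 * C)) ?_ ?_ ?_ <;>
    rw [interior_Icc] <;> intro q hq
  · exact ((hasDerivAt_detEntropy (hmem q hq)).comp q (hsq q)).hasDerivWithinAt
  · have h2 : HasDerivAt (fun q : ℝ => 2 * C * q) (2 * C) q := by
      simpa using (hasDerivAt_id q).const_mul (2 * C)
    exact (((hasDerivAt_detEntropyDeriv (hmem q hq)).comp q (hsq q)).mul h2).hasDerivWithinAt
  · have hp := detEntropyDeriv_pos (hmem q hq)
    have hc := two_mul_mul_detEntropyCurv_le_one (hmem q hq)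
    -- The second derivative is `2C H'(D) (1 - 2 D A(D))` at `D = Cq²`, so its sign is the bound `2
    -- D A(D) ≤ 1`.
    have : -(detEntropyDeriv (C * q ^ 2) * detEntropyCurv (C * q ^ 2)) * (2 * C * q)
      * (2 * C * q) + detEntropyDeriv (C * q ^ 2) * (2 * C) =
      detEntropyDeriv (C * q ^ 2) * (2 * C) *
        (1 - 2 * (C * q ^ 2) * detEntropyCurv (C * q ^ 2)) := by ring
    rw [this]
    exact mul_nonneg (by positivity) (by linarith)

/-! ### The determinant as a function of the entropy. -/

lemma exists_detEntropy_eq {y : ℝ} (hy : y ∈ Icc 0 (Real.log 2)) :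
    ∃ D ∈ Icc (0 : ℝ) (1 / 4), detEntropy D = y := by
  have := intermediate_value_Icc (by norm_num : (0 : ℝ) ≤ 1 / 4)
    continuous_detEntropy.continuousOn
  rw [detEntropy_zero, detEntropy_quarter] at this
  exact this hy

/-- The determinant of a qubit state as a function of its entropy: the inverse of `detEntropy`. -/
noncomputable def detOfEntropy : ℝ → ℝ := Function.invFunOn detEntropy (Icc 0 (1 / 4))

lemma detOfEntropy_mem {y : ℝ} (hy : y ∈ Icc 0 (Real.log 2)) :
    detOfEntropy y ∈ Icc (0 : ℝ) (1 / 4) :=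
  Function.invFunOn_mem (exists_detEntropy_eq hy)

lemma detEntropy_detOfEntropy {y : ℝ} (hy : y ∈ Icc 0 (Real.log 2)) :
    detEntropy (detOfEntropy y) = y :=
  Function.invFunOn_eq (exists_detEntropy_eq hy)

lemma detOfEntropy_detEntropy {D : ℝ} (hD : D ∈ Icc (0 : ℝ) (1 / 4)) :
    detOfEntropy (detEntropy D) = D :=
  strictMonoOn_detEntropy.injOn.leftInvOn_invFunOn hD

lemma strictMonoOn_detOfEntropy : StrictMonoOn detOfEntropy (Icc 0 (Real.log 2)) := by
  intro a ha b hb hab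
  rw [← strictMonoOn_detEntropy.lt_iff_lt (detOfEntropy_mem ha) (detOfEntropy_mem hb),
    detEntropy_detOfEntropy ha, detEntropy_detOfEntropy hb]
  exact hab

lemma detEntropy_mem {D : ℝ} (hD : D ∈ Icc (0 : ℝ) (1 / 4)) :
    detEntropy D ∈ Icc 0 (Real.log 2) := by
  rw [← detEntropy_zero, ← detEntropy_quarter]
  exact ⟨strictMonoOn_detEntropy.monotoneOn ⟨le_rfl, by norm_num⟩ hD hD.1,
    strictMonoOn_detEntropy.monotoneOn hD ⟨by norm_num, le_rfl⟩ hD.2⟩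

lemma continuousOn_detOfEntropy : ContinuousOn detOfEntropy (Icc 0 (Real.log 2)) := by
  have him : detOfEntropy '' Icc 0 (Real.log 2) = Icc 0 (1 / 4) := by
    refine Subset.antisymm (image_subset_iff.mpr fun y hy => detOfEntropy_mem hy) fun D hD =>
      ⟨detEntropy D, detEntropy_mem hD, detOfEntropy_detEntropy hD⟩
  let e := strictMonoOn_detOfEntropy.orderIso
  -- Order connectedness of the image makes its subspace topology the order topology, for which an
  -- order isomorphism is continuous.
  have : OrdConnected (detOfEntropy '' Icc 0 (Real.log 2)) := by rw [him]; exact ordConnected_Icc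
  have he : Continuous e := e.continuous
  rw [continuousOn_iff_continuous_domRestrict]
  exact continuous_subtype_val.comp he

lemma detOfEntropy_mem_Ioo {y : ℝ} (hy : y ∈ Ioo 0 (Real.log 2)) :
    detOfEntropy y ∈ Ioo (0 : ℝ) (1 / 4) := by
  have hy' := Ioo_subset_Icc_self hy
  have h := detOfEntropy_mem hy'
  have he := detEntropy_detOfEntropy hy'
  refine ⟨h.1.lt_of_ne fun h0 => ?_, h.2.lt_of_ne fun h0 => ?_⟩
  · rw [← h0, detEntropy_zero] at he; exact hy.1.ne he
  · rw [h0, detEntropy_quarter] at he; exact hy.2.ne' he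

lemma hasDerivAt_detOfEntropy {y : ℝ} (hy : y ∈ Ioo 0 (Real.log 2)) :
    HasDerivAt detOfEntropy (detEntropyDeriv (detOfEntropy y))⁻¹ y := by
  have hD := detOfEntropy_mem_Ioo hy
  refine HasDerivAt.of_local_left_inverse
    (continuousOn_detOfEntropy.continuousAt (Icc_mem_nhds hy.1 hy.2))
    (hasDerivAt_detEntropy hD) (detEntropyDeriv_pos hD).ne' ?_
  filter_upwards [Icc_mem_nhds hy.1 hy.2] with x hx using detEntropy_detOfEntropy hx

/-! ### Joint concavity of the output entropy for a degradable channel. -/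

/-- The pairs `(q, y)` of an excitation probability `q` of the input and an entropy `y` of the
environment output of an amplitude damping channel of transmissivity `1 - z`. -/
def envEntropySet (z : ℝ) : Set (ℝ × ℝ) :=
  {x | x.1 ∈ Icc (0 : ℝ) 1 ∧ detEntropy (z * (1 - z) * x.1 ^ 2) ≤ x.2 ∧
    x.2 ≤ Real.binEntropy (z * x.1)}

/-- The determinant of the channel output, given the excitation probability `x.1` of the input and
the entropy `x.2` of the environment output. -/
noncomputable def outputDet (z : ℝ) (x : ℝ × ℝ) : ℝ :=
  (1 - z) / z * detOfEntropy x.2 - (1 - z) * (1 - 2 * z) * x.1 ^ 2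

section

variable {z : ℝ}

lemma mul_one_sub_le_quarter (x : ℝ) : x * (1 - x) ≤ 1 / 4 := by
  nlinarith [sq_nonneg (x - 1 / 2)]

lemma mul_one_sub_mul_sq_mem (hz : z ∈ Icc (0 : ℝ) 1) {q : ℝ} (hq : q ∈ Icc (0 : ℝ) 1) :
    z * (1 - z) * q ^ 2 ∈ Icc (0 : ℝ) (1 / 4) := by
  have h0 : 0 ≤ z * (1 - z) := mul_nonneg hz.1 (by linarith [hz.2])
  have h1 : q ^ 2 ≤ 1 := pow_le_one₀ hq.1 hq.2
  exact ⟨by positivity, by nlinarith [mul_one_sub_le_quarter z]⟩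

lemma mul_one_sub_mem {x : ℝ} (hx : x ∈ Icc (0 : ℝ) 1) : x * (1 - x) ∈ Icc (0 : ℝ) (1 / 4) :=
  ⟨mul_nonneg hx.1 (by linarith [hx.2]), mul_one_sub_le_quarter x⟩

lemma mul_mem_Icc_zero_one {x y : ℝ} (hx : x ∈ Icc (0 : ℝ) 1) (hy : y ∈ Icc (0 : ℝ) 1) :
    x * y ∈ Icc (0 : ℝ) 1 :=
  ⟨mul_nonneg hx.1 hy.1, mul_le_one₀ hx.2 hy.1 hy.2⟩

lemma concaveOn_binEntropy_mul (hz : z ∈ Icc (0 : ℝ) 1) :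
    ConcaveOn ℝ (Icc 0 1) fun q => Real.binEntropy (z * q) := by
  refine ⟨convex_Icc 0 1, fun x hx y hy a b ha hb hab => ?_⟩
  have := Real.strictConcave_binEntropy.concaveOn.2 (mul_mem_Icc_zero_one hz hx)
    (mul_mem_Icc_zero_one hz hy) ha hb hab
  convert this using 2
  simp only [smul_eq_mul]; ring

/-- The region lies between a convex graph (`m = q²`, maximal coherence) and a concave one (`m = q`,
no coherence). -/
lemma convex_envEntropySet (hz : z ∈ Icc (0 : ℝ) 1) : Convex ℝ (envEntropySet z) := by
  have h1 : z * (1 - z) ∈ Icc (0 : ℝ) (1 / 4) := mul_one_sub_mem hz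
  have hA := (convexOn_detEntropy_mul_sq h1.1 h1.2).convex_epigraph
  have hB := (concaveOn_binEntropy_mul hz).convex_hypograph
  convert hA.inter hB using 1
  ext x
  simp only [envEntropySet, mem_ofPred_eq, mem_inter_iff]
  tauto

lemma snd_mem_of_mem_envEntropySet (hz : z ∈ Icc (0 : ℝ) 1) {x : ℝ × ℝ}
    (hx : x ∈ envEntropySet z) : x.2 ∈ Icc 0 (Real.log 2) :=
  ⟨(detEntropy_mem (mul_one_sub_mul_sq_mem hz hx.1)).1.trans hx.2.1,
    hx.2.2.trans Real.binEntropy_le_log_two⟩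

lemma detOfEntropy_bounds (hz : z ∈ Icc (0 : ℝ) 1) {x : ℝ × ℝ} (hx : x ∈ envEntropySet z) :
    z * (1 - z) * x.1 ^ 2 ≤ detOfEntropy x.2 ∧
      detOfEntropy x.2 ≤ z * x.1 * (1 - z * x.1) := by
  have hy := snd_mem_of_mem_envEntropySet hz hx
  constructor
  · rw [← strictMonoOn_detEntropy.le_iff_le (mul_one_sub_mul_sq_mem hz hx.1)
      (detOfEntropy_mem hy), detEntropy_detOfEntropy hy]
    exact hx.2.1
  · rw [← strictMonoOn_detEntropy.le_iff_le (detOfEntropy_mem hy)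
      (mul_one_sub_mem (mul_mem_Icc_zero_one hz hx.1)), detEntropy_detOfEntropy hy,
      detEntropy_mul_one_sub]
    exact hx.2.2

/-- In terms of `m`, the difference of the two determinants is `(1 - 2z)(m - q²)`. This is where
degradability, `z < 1/2`, enters. -/
lemma le_outputDet (h0 : 0 < z) (h1 : z < 1 / 2) {x : ℝ × ℝ}
    (hx : z * (1 - z) * x.1 ^ 2 ≤ detOfEntropy x.2) : detOfEntropy x.2 ≤ outputDet z x := by
  have : outputDet z x - detOfEntropy x.2 =
      (1 - 2 * z) / z * (detOfEntropy x.2 - z * (1 - z) * x.1 ^ 2) := by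
    unfold outputDet; field_simp; ring
  have h2 : 0 ≤ (1 - 2 * z) / z * (detOfEntropy x.2 - z * (1 - z) * x.1 ^ 2) :=
    mul_nonneg (div_nonneg (by linarith) h0.le) (by linarith)
  linarith

lemma outputDet_add (h0 : 0 < z) (x : ℝ × ℝ) :
    outputDet z x + (1 - z) / z * (z * x.1 * (1 - z * x.1) - detOfEntropy x.2) =
      (1 - z) * x.1 * (1 - (1 - z) * x.1) := by
  unfold outputDet; field_simp; ring

/-- The quadratic form inequality behind the joint concavity of the output entropy. -/
lemma curvature_inequality {k c q D u AD Au X b : ℝ} (hk : 0 < k) (hc : 0 ≤ c) (hD : 0 < D)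
    (hAu : 0 < Au) (hu : k * D - c * q ^ 2 = u) (hA : D * AD ≤ u * Au) (hA1 : 2 * u * Au ≤ 1) :
    k * (AD * X ^ 2) - 2 * c * b ^ 2 ≤ Au * (k * X - c * (2 * q * b)) ^ 2 := by
  have hcq : 0 ≤ c * q ^ 2 := by positivity
  have hT : 0 < 1 + 2 * c * q ^ 2 * Au := by nlinarith
  -- This removes `AD`. After multiplication by `D` and use of `hA`, what remains is `Au (kD - u)(1
  -- - 2uAu) ≥ 0`, where `kD - u = cq²`.
  have key : AD * (1 + 2 * c * q ^ 2 * Au) ≤ k * Au := by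
    have h1 : D * (AD * (1 + 2 * c * q ^ 2 * Au)) ≤ D * (k * Au) := by
      have h2 : D * AD * (1 + 2 * c * q ^ 2 * Au) ≤ u * Au * (1 + 2 * c * q ^ 2 * Au) :=
        mul_le_mul_of_nonneg_right hA hT.le
      have h3 : 0 ≤ Au * ((k * D - u) * (1 - 2 * u * Au)) :=
        mul_nonneg hAu.le (mul_nonneg (by linarith) (by linarith))
      have h4 : c * q ^ 2 = k * D - u := by linarith
      have h5 : 2 * c * q ^ 2 * Au = 2 * (k * D - u) * Au := by rw [← h4]; ring
      rw [h5] at h2 ⊢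
      linarith
    exact le_of_mul_le_mul_left h1 hD
  have h6 : (1 + 2 * c * q ^ 2 * Au) * (k * (AD * X ^ 2)) ≤ Au * (k * X) ^ 2 := by
    have := mul_le_mul_of_nonneg_left key (by positivity : 0 ≤ k * X ^ 2)
    linarith
  have h7 : Au * (k * X) ^ 2 ≤ (1 + 2 * c * q ^ 2 * Au) *
      (Au * (k * X - c * (2 * q * b)) ^ 2 + 2 * c * b ^ 2) := by
    -- The two sides of `h7` differ by exactly this completed square.
    have : 0 ≤ 2 * c * (b - q * Au * (k * X - c * (2 * q * b))) ^ 2 := by positivity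
    linarith
  have := le_of_mul_le_mul_left (h6.trans h7) hT
  linarith

/-- Zero environment entropy forces population `0`, so the origin is the only point of the region at
height `0` and at most one endpoint can be there. With the next lemma this keeps open segments where
`H` and its inverse are differentiable. -/
lemma pos_of_mem_openSegment (hz : z ∈ Ioo (0 : ℝ) 1) {x y : ℝ × ℝ} (hx : x ∈ envEntropySet z)
    (hy : y ∈ envEntropySet z) (hne : x ≠ y) {t : ℝ} (ht : t ∈ Ioo (0 : ℝ) 1) :
    0 < x.2 + t * (y.2 - x.2) := by
  have hz' := Ioo_subset_Icc_self hz
  have hx2 := snd_mem_of_mem_envEntropySet hz' hx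
  have hy2 := snd_mem_of_mem_envEntropySet hz' hy
  have hfst : ∀ w ∈ envEntropySet z, w.2 = 0 → w.1 = 0 := by
    intro w hw h
    have hC : 0 < z * (1 - z) := mul_pos hz.1 (by linarith [hz.2])
    have hm := mul_one_sub_mul_sq_mem hz' hw.1
    have := hw.2.1
    rw [h, ← detEntropy_zero, strictMonoOn_detEntropy.le_iff_le hm ⟨le_rfl, by norm_num⟩] at this
    have h3 : w.1 ^ 2 ≤ 0 := by by_contra h'; push Not at h'; nlinarith
    exact pow_eq_zero_iff two_ne_zero |>.mp (le_antisymm h3 (sq_nonneg _))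
  have hsplit : x.2 + t * (y.2 - x.2) = (1 - t) * x.2 + t * y.2 := by ring
  rw [hsplit]
  rcases hx2.1.eq_or_lt with h | h
  · rcases hy2.1.eq_or_lt with h' | h'
    · exact absurd (Prod.ext ((hfst x hx h.symm).trans (hfst y hy h'.symm).symm)
        (h.symm.trans h')) hne
    · rw [← h]; have := mul_pos ht.1 h'; linarith
  · have := mul_pos (sub_pos.mpr ht.2) h
    have := mul_nonneg ht.1.le hy2.1
    linarith

/-- If the populations differ, the upper boundary is strictly concave between them; if they agree,
the lower endpoint is strictly below the boundary. -/
lemma lt_binEntropy_of_mem_openSegment (hz : z ∈ Ioo (0 : ℝ) 1) {x y : ℝ × ℝ}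
    (hx : x ∈ envEntropySet z) (hy : y ∈ envEntropySet z) (hne : x ≠ y) {t : ℝ}
    (ht : t ∈ Ioo (0 : ℝ) 1) :
    x.2 + t * (y.2 - x.2) < Real.binEntropy (z * (x.1 + t * (y.1 - x.1))) := by
  have hz' := Ioo_subset_Icc_self hz
  have ht' : 0 < 1 - t := sub_pos.mpr ht.2
  by_cases h : x.1 = y.1
  · have h2 : x.2 ≠ y.2 := fun h2 => hne (Prod.ext h h2)
    have hxb := hx.2.2
    have hyb := hy.2.2
    have e : x.1 + t * (y.1 - x.1) = y.1 := by rw [h]; ring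
    rw [e]
    rw [h] at hxb
    rcases h2.lt_or_gt with h3 | h3 <;> nlinarith [ht.1, ht']
  · have := Real.strictConcave_binEntropy.2 (mul_mem_Icc_zero_one hz' hx.1)
      (mul_mem_Icc_zero_one hz' hy.1) (fun h' => h (mul_left_cancel₀ hz.1.ne' h')) ht' ht.1
      (by ring)
    have e : z * (x.1 + t * (y.1 - x.1)) = (1 - t) • (z * x.1) + t • (z * y.1) := by
      simp only [smul_eq_mul]; ring
    rw [e]
    refine lt_of_le_of_lt ?_ this
    simp only [smul_eq_mul]
    have h1 := mul_le_mul_of_nonneg_left hx.2.2 ht'.le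
    have h2 := mul_le_mul_of_nonneg_left hy.2.2 ht.1.le
    linarith

lemma segment_mem_envEntropySet (hz : z ∈ Icc (0 : ℝ) 1) {x y : ℝ × ℝ}
    (hx : x ∈ envEntropySet z) (hy : y ∈ envEntropySet z) {t : ℝ} (ht : t ∈ Icc (0 : ℝ) 1) :
    (x.1 + t * (y.1 - x.1), x.2 + t * (y.2 - x.2)) ∈ envEntropySet z := by
  have := convex_envEntropySet hz hx hy (sub_nonneg.mpr ht.2) ht.1 (by ring)
  convert this using 1
  ext <;> simp <;> ring

lemma outputDet_mem_Ioo (h0 : 0 < z) (h1 : z < 1 / 2) {x : ℝ × ℝ} (hx : x ∈ envEntropySet z)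
    (hpos : 0 < x.2) (hlt : x.2 < Real.binEntropy (z * x.1)) :
    outputDet z x ∈ Ioo (0 : ℝ) (1 / 4) := by
  have hz : z ∈ Icc (0 : ℝ) 1 := ⟨h0.le, by linarith⟩
  have hy : x.2 ∈ Ioo 0 (Real.log 2) := ⟨hpos, hlt.trans_le Real.binEntropy_le_log_two⟩
  have hD := detOfEntropy_mem_Ioo hy
  have hb := detOfEntropy_bounds hz hx
  refine ⟨hD.1.trans_le (le_outputDet h0 h1 hb.1), ?_⟩
  have hlt' : detOfEntropy x.2 < z * x.1 * (1 - z * x.1) := by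
    rw [← strictMonoOn_detEntropy.lt_iff_lt (Ioo_subset_Icc_self hD)
      (mul_one_sub_mem (mul_mem_Icc_zero_one hz hx.1)), detEntropy_mul_one_sub,
      detEntropy_detOfEntropy (Ioo_subset_Icc_self hy)]
    exact hlt
  have h2 : 0 < (1 - z) / z * (z * x.1 * (1 - z * x.1) - detOfEntropy x.2) :=
    mul_pos (div_pos (by linarith) h0) (by linarith)
  have := outputDet_add h0 x
  have := mul_one_sub_le_quarter ((1 - z) * x.1)
  linarith

/-- For a degradable amplitude damping channel the output entropy is jointly concave in the
excitation probability of the input and the entropy of the environment. -/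
lemma concaveOn_detEntropy_outputDet (h0 : 0 < z) (h1 : z < 1 / 2) :
    ConcaveOn ℝ (envEntropySet z) fun x => detEntropy (outputDet z x) := by
  have hz : z ∈ Icc (0 : ℝ) 1 := ⟨h0.le, by linarith⟩
  have hz' : z ∈ Ioo (0 : ℝ) 1 := ⟨h0, by linarith⟩
  refine ⟨convex_envEntropySet hz, fun x hx y hy a t ha ht hat => ?_⟩
  -- A constant segment may lie on the boundary, where the second derivative test does not apply.
  by_cases hne : x = y
  · subst hne
    rw [Convex.combo_self hat, Convex.combo_self hat]
  set k := (1 - z) / z with hk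
  set c := (1 - z) * (1 - 2 * z) with hc
  have hkpos : 0 < k := div_pos (by linarith) h0
  have hcpos : 0 ≤ c := mul_nonneg (by linarith) (by linarith)
  set b := y.1 - x.1 with hb
  set v := y.2 - x.2 with hv
  let Q : ℝ → ℝ := fun t => x.1 + t * b
  let Y : ℝ → ℝ := fun t => x.2 + t * v
  let D : ℝ → ℝ := fun t => detOfEntropy (Y t)
  let U : ℝ → ℝ := fun t => outputDet z (Q t, Y t)
  have hmem : ∀ t ∈ Icc (0 : ℝ) 1, (Q t, Y t) ∈ envEntropySet z := fun t ht =>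
    segment_mem_envEntropySet hz hx hy ht
  have hYm : ∀ t ∈ Ioo (0 : ℝ) 1, Y t ∈ Ioo 0 (Real.log 2) := fun t ht =>
    ⟨pos_of_mem_openSegment hz' hx hy hne ht,
      (lt_binEntropy_of_mem_openSegment hz' hx hy hne ht).trans_le Real.binEntropy_le_log_two⟩
  have hDm : ∀ t ∈ Ioo (0 : ℝ) 1, D t ∈ Ioo (0 : ℝ) (1 / 4) := fun t ht =>
    detOfEntropy_mem_Ioo (hYm t ht)
  have hUm : ∀ t ∈ Ioo (0 : ℝ) 1, U t ∈ Ioo (0 : ℝ) (1 / 4) := fun t ht =>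
    outputDet_mem_Ioo h0 h1 (hmem t (Ioo_subset_Icc_self ht))
      (pos_of_mem_openSegment hz' hx hy hne ht)
      (lt_binEntropy_of_mem_openSegment hz' hx hy hne ht)
  have hDU : ∀ t ∈ Ioo (0 : ℝ) 1, D t ≤ U t := fun t ht =>
    le_outputDet h0 h1 (detOfEntropy_bounds hz (hmem t (Ioo_subset_Icc_self ht))).1
  have hQd : ∀ t, HasDerivAt Q b t := fun t => by
    refine (((hasDerivAt_id t).mul_const b).const_add x.1).congr_deriv (one_mul b)
  have hYd : ∀ t, HasDerivAt Y v t := fun t => by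
    refine (((hasDerivAt_id t).mul_const v).const_add x.2).congr_deriv (one_mul v)
  have hDd : ∀ t ∈ Ioo (0 : ℝ) 1, HasDerivAt D ((detEntropyDeriv (D t))⁻¹ * v) t := fun t ht =>
    (hasDerivAt_detOfEntropy (hYm t ht)).comp t (hYd t)
  have hUd : ∀ t ∈ Ioo (0 : ℝ) 1, HasDerivAt U
      (k * ((detEntropyDeriv (D t))⁻¹ * v) - c * (2 * Q t * b)) t := fun t ht => by
    refine (((hDd t ht).const_mul k).sub (((hQd t).pow 2).const_mul c)).congr_deriv ?_
    simp
  have hcont : ContinuousOn (fun t => detEntropy (U t)) (Icc 0 1) := by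
    refine continuous_detEntropy.comp_continuousOn ?_
    have hY : ContinuousOn Y (Icc 0 1) := fun t _ => (hYd t).continuousAt.continuousWithinAt
    have hQ : ContinuousOn Q (Icc 0 1) := fun t _ => (hQd t).continuousAt.continuousWithinAt
    have hDc : ContinuousOn D (Icc 0 1) := continuousOn_detOfEntropy.comp hY
      fun t ht => snd_mem_of_mem_envEntropySet hz (hmem t ht)
    exact (hDc.const_mul k).sub ((hQ.pow 2).const_mul c)
  have hconc : ConcaveOn ℝ (Icc 0 1) fun t => detEntropy (U t) := by
    -- Since `H(D) = Y` is affine in `t`, `D' = v / H'(D)` and `D'' = A(D) D'²`. Hence `U'' = k A(D)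
    -- D'² - 2cb²`, and `(H ∘ U)'' = H'(U) (U'' - A(U) U'²)`.
    refine concaveOn_of_hasDerivWithinAt2_nonpos (convex_Icc 0 1) hcont
      (f' := fun t => detEntropyDeriv (U t) *
        (k * ((detEntropyDeriv (D t))⁻¹ * v) - c * (2 * Q t * b)))
      (f'' := fun t => detEntropyDeriv (U t) *
        ((k * (detEntropyCurv (D t) * ((detEntropyDeriv (D t))⁻¹ * v) ^ 2) - 2 * c * b ^ 2) -
          detEntropyCurv (U t) *
            (k * ((detEntropyDeriv (D t))⁻¹ * v) - c * (2 * Q t * b)) ^ 2)) ?_ ?_ ?_ <;>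
      rw [interior_Icc] <;> intro t ht
    · exact ((hasDerivAt_detEntropy (hUm t ht)).comp t (hUd t ht)).hasDerivWithinAt
    · have hp := (detEntropyDeriv_pos (hDm t ht)).ne'
      have hA := (hasDerivAt_detEntropyDeriv (hUm t ht)).comp t (hUd t ht)
      have hB := (((hasDerivAt_detEntropyDeriv (hDm t ht)).comp t (hDd t ht)).inv hp).mul_const v
      have hC := ((hQd t).const_mul 2).mul_const b
      refine (hA.mul ((hB.const_mul k).sub (hC.const_mul c))).congr_deriv ?_
        |>.hasDerivWithinAt
      simp only [Function.comp_apply, Pi.sub_apply, Pi.inv_apply]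
      field_simp
      ring
    · refine mul_nonpos_of_nonneg_of_nonpos (detEntropyDeriv_pos (hUm t ht)).le ?_
      rw [sub_nonpos]
      exact curvature_inequality hkpos hcpos (hDm t ht).1 (detEntropyCurv_pos (hUm t ht)) rfl
        (mul_detEntropyCurv_mono (hDm t ht) (hUm t ht) (hDU t ht))
        (two_mul_mul_detEntropyCurv_le_one (hUm t ht))
  have := hconc.2 (left_mem_Icc.mpr zero_le_one) (right_mem_Icc.mpr zero_le_one) ha ht hat
  have ea : a = 1 - t := by linarith
  have e0 : (Q 0, Y 0) = x := by simp [Q, Y]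
  have e1 : (Q 1, Y 1) = y := by simp [Q, Y, b, v]
  have et : (Q (a • 0 + t • 1), Y (a • 0 + t • 1)) = a • x + t • y := by
    ext <;> simp [Q, Y, b, v, ea] <;> ring
  simpa only [U, e0, e1, et] using this

end

/-! ### Domination of an ensemble by one letter. -/

lemma mem_Icc_of_sq_le {q m : ℝ} (h1 : q ^ 2 ≤ m) (h2 : m ≤ q) : q ∈ Icc (0 : ℝ) 1 := by
  constructor <;> nlinarith

lemma det_bounds {z q m : ℝ} (hz : z ∈ Icc (0 : ℝ) 1) (h1 : q ^ 2 ≤ m) (h2 : m ≤ q) :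
    z * (1 - z) * q ^ 2 ≤ z * (m - z * q ^ 2) ∧
      z * (m - z * q ^ 2) ≤ z * q * (1 - z * q) := by
  have := mul_le_mul_of_nonneg_left h1 hz.1
  have := mul_le_mul_of_nonneg_left h2 hz.1
  constructor <;> linarith

lemma det_mem {z q m : ℝ} (hz : z ∈ Icc (0 : ℝ) 1) (h1 : q ^ 2 ≤ m) (h2 : m ≤ q) :
    z * (m - z * q ^ 2) ∈ Icc (0 : ℝ) (1 / 4) := by
  have hq := mem_Icc_of_sq_le h1 h2
  have hb := det_bounds hz h1 h2
  exact ⟨(mul_one_sub_mul_sq_mem hz hq).1.trans hb.1,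
    hb.2.trans (mul_one_sub_mem (mul_mem_Icc_zero_one hz hq)).2⟩

lemma detEntropy_le_binEntropy {z q m : ℝ} (hz : z ∈ Icc (0 : ℝ) 1) (h1 : q ^ 2 ≤ m)
    (h2 : m ≤ q) : detEntropy (z * (m - z * q ^ 2)) ≤ Real.binEntropy (z * q) := by
  rw [← detEntropy_mul_one_sub]
  exact strictMonoOn_detEntropy.monotoneOn (det_mem hz h1 h2)
    (mul_one_sub_mem (mul_mem_Icc_zero_one hz (mem_Icc_of_sq_le h1 h2))) (det_bounds hz h1 h2).2

lemma detEntropy_sq_le {z q m : ℝ} (hz : z ∈ Icc (0 : ℝ) 1) (h1 : q ^ 2 ≤ m)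
    (h2 : m ≤ q) : detEntropy (z * (1 - z) * q ^ 2) ≤ detEntropy (z * (m - z * q ^ 2)) :=
  strictMonoOn_detEntropy.monotoneOn (mul_one_sub_mul_sq_mem hz (mem_Icc_of_sq_le h1 h2))
    (det_mem hz h1 h2) (det_bounds hz h1 h2).1

section

variable {ι : Type*} [Fintype ι] {w q m : ι → ℝ}

/-- Any ensemble is dominated by a single letter with the same mean excitation probability. -/
lemma exists_dominating_letter {η : ℝ} (hη : η ∈ Icc (0 : ℝ) 1) (hw : ∀ i, 0 ≤ w i)
    (hw1 : ∑ i, w i = 1) (h1 : ∀ i, q i ^ 2 ≤ m i) (h2 : ∀ i, m i ≤ q i) :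
    ∃ p M : ℝ, p = ∑ i, w i * q i ∧ p ^ 2 ≤ M ∧ M ≤ p ∧
      ∑ i, w i * (detEntropy (η * (m i - η * q i ^ 2)) -
          detEntropy ((1 - η) * (m i - (1 - η) * q i ^ 2))) ≤
        detEntropy (η * (M - η * p ^ 2)) - detEntropy ((1 - η) * (M - (1 - η) * p ^ 2)) ∧
      detEntropy ((1 - η) * (M - (1 - η) * p ^ 2)) ≤
        ∑ i, w i * detEntropy ((1 - η) * (m i - (1 - η) * q i ^ 2)) := by
  set z := 1 - η with hzdef
  have hηz : η = 1 - z := by rw [hzdef]; ring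
  have hz : z ∈ Icc (0 : ℝ) 1 := ⟨by linarith [hη.2], by linarith [hη.1]⟩
  have hq := fun i => mem_Icc_of_sq_le (h1 i) (h2 i)
  have hp : ∑ i, w i * q i ∈ Icc (0 : ℝ) 1 :=
    (convex_Icc (0 : ℝ) 1).sum_mem (t := Finset.univ) (fun i _ => hw i) hw1 fun i _ => hq i
  set p := ∑ i, w i * q i with hpdef
  have hpp : p ^ 2 ≤ p := by nlinarith [hp.1, hp.2]
  rcases le_or_gt η (1 / 2) with hle | hgt
  -- At `M = p²` both determinants equal `η(1-η)p²`, so the coherent information is `0`; for `η ≤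
  -- 1/2` no letter has more.
  · refine ⟨p, p ^ 2, rfl, le_rfl, hpp, ?_, ?_⟩
    · have e : η * (p ^ 2 - η * p ^ 2) = z * (p ^ 2 - z * p ^ 2) := by rw [hηz]; ring
      rw [e, sub_self]
      refine Finset.sum_nonpos fun i _ => mul_nonpos_of_nonneg_of_nonpos (hw i) ?_
      rw [sub_nonpos]
      refine strictMonoOn_detEntropy.monotoneOn (det_mem hη (h1 i) (h2 i))
        (det_mem hz (h1 i) (h2 i)) ?_
      have : 0 ≤ (1 - 2 * η) * (m i - q i ^ 2) :=
        mul_nonneg (by linarith) (by linarith [h1 i])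
      rw [hzdef]
      linarith
    · have hC := mul_one_sub_mem hz
      have := (convexOn_detEntropy_mul_sq hC.1 hC.2).map_sum_le (t := Finset.univ)
        (fun i _ => hw i) hw1 fun i _ => hq i
      simp only [smul_eq_mul] at this
      rw [← hpdef] at this
      have e : z * (p ^ 2 - z * p ^ 2) = z * (1 - z) * p ^ 2 := by ring
      rw [e]
      exact this.trans (Finset.sum_le_sum fun i _ =>
        mul_le_mul_of_nonneg_left (detEntropy_sq_le hz (h1 i) (h2 i)) (hw i))
  rcases hz.1.eq_or_lt with h0 | h0
  · have hη1 : η = 1 := by linarith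
    -- For the noiseless channel the environment entropy vanishes, so `M = p` is taken to maximize
    -- the output entropy.
    refine ⟨p, p, rfl, hpp, le_rfl, ?_, ?_⟩
    · rw [← h0]
      simp only [zero_mul, detEntropy_zero, sub_zero]
      have e : η * (p - η * p ^ 2) = η * p * (1 - η * p) := by ring
      rw [e, detEntropy_mul_one_sub]
      have := (concaveOn_binEntropy_mul hη).le_map_sum (t := Finset.univ)
        (fun i _ => hw i) hw1 fun i _ => hq i
      simp only [smul_eq_mul] at this
      rw [← hpdef] at this
      exact (Finset.sum_le_sum fun i _ => mul_le_mul_of_nonneg_left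
        (detEntropy_le_binEntropy hη (h1 i) (h2 i)) (hw i)).trans this
    · rw [← h0]
      simp [detEntropy_zero]
  · have hz2 : z < 1 / 2 := by linarith
    let x : ι → ℝ × ℝ := fun i => (q i, detEntropy (z * (m i - z * q i ^ 2)))
    have hx : ∀ i, x i ∈ envEntropySet z := fun i =>
      ⟨hq i, detEntropy_sq_le hz (h1 i) (h2 i), detEntropy_le_binEntropy hz (h1 i) (h2 i)⟩
    have hxo : ∀ i, outputDet z (x i) = η * (m i - η * q i ^ 2) := fun i => by
      simp only [outputDet, x]
      rw [detOfEntropy_detEntropy (det_mem hz (h1 i) (h2 i)), hηz]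
      field_simp
      ring
    set y := ∑ i, w i * detEntropy (z * (m i - z * q i ^ 2)) with hy
    have hsum : ∑ i, w i • x i = (p, y) := by
      ext
      · simp [x, hpdef, Prod.fst_sum]
      · simp [x, hy, Prod.snd_sum]
    have hmem : (p, y) ∈ envEntropySet z := by
      rw [← hsum]
      exact (convex_envEntropySet hz).sum_mem (fun i _ => hw i) hw1 fun i _ => hx i
    have hconc := (concaveOn_detEntropy_outputDet h0 hz2).le_map_sum (t := Finset.univ)
      (fun i _ => hw i) hw1 fun i _ => hx i
    rw [hsum] at hconc
    simp only [hxo, smul_eq_mul] at hconc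
    have hb := detOfEntropy_bounds hz hmem
    have hyD := detEntropy_detOfEntropy (snd_mem_of_mem_envEntropySet hz hmem)
    simp only at hb hyD
    -- `M` solves `z(M - zp²) = detOfEntropy y`: the single letter has exactly the average
    -- environment entropy `y`.
    set M := detOfEntropy y / z + z * p ^ 2 with hM
    have hMD : z * (M - z * p ^ 2) = detOfEntropy y := by rw [hM]; field_simp; ring
    have hMo : outputDet z (p, y) = η * (M - η * p ^ 2) := by
      simp only [outputDet]
      rw [hM, hηz]
      field_simp
      ring
    refine ⟨p, M, rfl, ?_, ?_, ?_, ?_⟩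
    · refine le_of_mul_le_mul_left ?_ h0
      linarith [hb.1]
    · refine le_of_mul_le_mul_left ?_ h0
      linarith [hb.2]
    · simp only [mul_sub, Finset.sum_sub_distrib]
      rw [hMo] at hconc
      simp only [← mul_sub]
      rw [hMD, hyD]
      linarith
    · rw [hMD, hyD]

end

/-! ### Von Neumann entropy through the roots of the characteristic polynomial. -/

open Polynomial in
/-- The entropy in bits of the multiset of roots of a polynomial. -/
noncomputable def rootEntropy (P : ℂ[X]) : ℝ :=
  (P.roots.map fun c => Real.negMulLog c.re).sum / Real.log 2

section

open Polynomial

lemma rootEntropy_mul {P Q : ℂ[X]} (h : P * Q ≠ 0) :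
    rootEntropy (P * Q) = rootEntropy P + rootEntropy Q := by
  rw [rootEntropy, roots_mul h, Multiset.map_add, Multiset.sum_add, add_div]; rfl

lemma rootEntropy_X_sub_C (a : ℂ) :
    rootEntropy (X - C a) = Real.negMulLog a.re / Real.log 2 := by
  simp [rootEntropy]

lemma rootEntropy_X_pow (n : ℕ) : rootEntropy (X ^ n : ℂ[X]) = 0 := by
  simp [rootEntropy, Multiset.map_nsmul, Multiset.sum_nsmul]

lemma rootEntropy_prod {ι : Type*} (s : Finset ι) (P : ι → ℂ[X]) (h : ∀ i ∈ s, (P i).Monic) :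
    rootEntropy (∏ i ∈ s, P i) = ∑ i ∈ s, rootEntropy (P i) := by
  classical
  induction s using Finset.induction_on with
  | empty => simp [rootEntropy]
  | insert a s ha ih =>
    have hs := fun i hi => h i (Finset.mem_insert_of_mem hi)
    have hne : P a * ∏ i ∈ s, P i ≠ 0 :=
      ((h a (Finset.mem_insert_self a s)).mul (monic_prod_of_monic s P hs)).ne_zero
    rw [Finset.prod_insert ha, Finset.sum_insert ha, rootEntropy_mul hne, ih hs]

end

/-- The block diagonal matrix `∑ₓ |x⟩⟨x| ⊗ M x`, the block label being the first index. -/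
def blockSum {ι κ : Type*} [DecidableEq ι] (M : ι → Matrix κ κ ℂ) : Matrix (ι × κ) (ι × κ) ℂ :=
  Matrix.of fun i j => if i.1 = j.1 then M i.1 i.2 j.2 else 0

lemma isHermitian_blockSum {ι κ : Type*} [DecidableEq ι] {M : ι → Matrix κ κ ℂ} (hM : ∀ x, (M x).IsHermitian) :
    (blockSum M).IsHermitian := by
  ext ⟨i, a⟩ ⟨j, b⟩
  by_cases h : i = j
  · subst h
    simpa [blockSum] using (hM i).apply a b
  · simp [blockSum, h, Ne.symm h]

section

variable {ι κ : Type*} [Fintype ι] [DecidableEq ι] [Fintype κ] [DecidableEq κ]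

lemma vnEntropy_eq_rootEntropy {ρ : Matrix ι ι ℂ} (hρ : ρ.IsHermitian) :
    vnEntropy ρ = rootEntropy ρ.charpoly := by
  have h1 : vnEntropy ρ = ∑ i, Real.negMulLog (hρ.eigenvalues i) / Real.log 2 := by
    rw [vnEntropy, hρ.cfc_eq, Matrix.IsHermitian.cfc, Unitary.conjStarAlgAut_apply,
      Matrix.trace_mul_cycle, Unitary.coe_star_mul_self, one_mul, Matrix.trace_diagonal,
      Complex.re_sum]
    refine Finset.sum_congr rfl fun i _ => ?_
    simp only [Function.comp_apply, Real.negMulLog, Real.logb]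
    rw [RCLike.ofReal_eq_complex_ofReal, Complex.ofReal_re]
    ring
  rw [h1, hρ.charpoly_eq, rootEntropy_prod _ _ fun i _ => Polynomial.monic_X_sub_C _]
  simp [rootEntropy_X_sub_C]

/-- The two characteristic polynomials agree up to powers of `X`, whose zero roots carry no entropy.
-/
lemma vnEntropy_mul_conjTranspose_comm (W : Matrix ι κ ℂ) :
    vnEntropy (W * Wᴴ) = vnEntropy (Wᴴ * W) := by
  rw [vnEntropy_eq_rootEntropy (Matrix.isHermitian_mul_conjTranspose_self W),
    vnEntropy_eq_rootEntropy (Matrix.isHermitian_conjTranspose_mul_self W)]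
  have h := congrArg rootEntropy (Matrix.charpoly_mul_comm' W Wᴴ)
  rw [rootEntropy_mul ((Polynomial.monic_X_pow _).mul (Matrix.charpoly_monic _)).ne_zero,
    rootEntropy_mul ((Polynomial.monic_X_pow _).mul (Matrix.charpoly_monic _)).ne_zero,
    rootEntropy_X_pow, rootEntropy_X_pow, zero_add, zero_add] at h
  exact h

lemma charpoly_blockSum (M : ι → Matrix κ κ ℂ) :
    (blockSum M).charpoly = ∏ x, (M x).charpoly := by
  have h : blockSum M = Matrix.reindex (Equiv.prodComm κ ι) (Equiv.prodComm κ ι)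
      (Matrix.blockDiagonal M) := by
    ext i j
    simp [blockSum, Matrix.blockDiagonal_apply]
  have h2 : (Matrix.blockDiagonal M).charmatrix =
      Matrix.blockDiagonal fun x => (M x).charmatrix := by
    ext ⟨i, x⟩ ⟨j, y⟩
    by_cases hxy : x = y
    · subst hxy
      simp [Matrix.charmatrix_apply, Matrix.blockDiagonal_apply, Matrix.diagonal_apply]
    · simp [Matrix.blockDiagonal_apply, hxy]
  rw [h, Matrix.charpoly_reindex, Matrix.charpoly, h2, Matrix.det_blockDiagonal]
  rfl

lemma vnEntropy_blockSum {M : ι → Matrix κ κ ℂ} (hM : ∀ x, (M x).IsHermitian) :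
    vnEntropy (blockSum M) = ∑ x, vnEntropy (M x) := by
  rw [vnEntropy_eq_rootEntropy (isHermitian_blockSum hM), charpoly_blockSum,
    rootEntropy_prod _ _ fun x _ => Matrix.charpoly_monic _]
  exact Finset.sum_congr rfl fun x _ => (vnEntropy_eq_rootEntropy (hM x)).symm

lemma vnEntropy_diagonal (p : ι → ℝ) :
    vnEntropy (Matrix.diagonal fun x => (p x : ℂ)) =
      (∑ x, Real.negMulLog (p x)) / Real.log 2 := by
  have h : (Matrix.diagonal fun x => (p x : ℂ)).IsHermitian := by
    rw [Matrix.isHermitian_diagonal_iff]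
    intro x
    simp [isSelfAdjoint_iff]
  rw [vnEntropy_eq_rootEntropy h, Matrix.charpoly_diagonal,
    rootEntropy_prod _ _ fun i _ => Polynomial.monic_X_sub_C _, Finset.sum_div]
  simp [rootEntropy_X_sub_C]

end

/-! ### Qubit blocks and the action of the channel. -/

/-- The entropy of an unnormalized qubit state of trace `t` and determinant `t² D`. -/
lemma vnEntropy_fin_two {M : Matrix (Fin 2) (Fin 2) ℂ} (hM : M.IsHermitian) {t D : ℝ}
    (hD : D ≤ 1 / 4) (htr : M.trace = t) (hdet : M.det = (t ^ 2 * D : ℝ)) :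
    vnEntropy M = (Real.negMulLog t + t * detEntropy D) / Real.log 2 := by
  set r := √(1 - 4 * D) with hr
  have hsq : r ^ 2 = 1 - 4 * D := Real.sq_sqrt (by linarith)
  have hP : M.charpoly = (Polynomial.X - Polynomial.C ((t * ((1 + r) / 2) : ℝ) : ℂ)) *
      (Polynomial.X - Polynomial.C ((t * (1 - (1 + r) / 2) : ℝ) : ℂ)) := by
    have hs : (M.trace) = ((t * ((1 + r) / 2) : ℝ) : ℂ) + ((t * (1 - (1 + r) / 2) : ℝ) : ℂ) := by
      rw [htr, ← Complex.ofReal_add]; congr 1; ring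
    have hp : M.det = ((t * ((1 + r) / 2) : ℝ) : ℂ) * ((t * (1 - (1 + r) / 2) : ℝ) : ℂ) := by
      rw [hdet, ← Complex.ofReal_mul]; congr 1
      have : D = (1 - r ^ 2) / 4 := by rw [hsq]; ring
      rw [this]; ring
    rw [Matrix.charpoly_fin_two, hs, hp, Polynomial.C_add, Polynomial.C_mul]
    ring
  rw [vnEntropy_eq_rootEntropy hM, hP, rootEntropy_mul
    ((Polynomial.monic_X_sub_C _).mul (Polynomial.monic_X_sub_C _)).ne_zero,
    rootEntropy_X_sub_C, rootEntropy_X_sub_C, Complex.ofReal_re, Complex.ofReal_re,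
    Real.negMulLog_mul, Real.negMulLog_mul, detEntropy,
    Real.binEntropy_eq_negMulLog_add_negMulLog_one_sub]
  ring

/-- The state vector after the Kraus operator `j` has acted on the qubit. -/
noncomputable def dampedVec {α : Type*} (η : ℝ) (φ : α × Fin 2 → ℂ) (j : Fin 2)
    (i : α × Fin 2) : ℂ :=
  kraus η j i.2 0 * φ (i.1, 0) + kraus η j i.2 1 * φ (i.1, 1)

lemma dampSnd_vecMulVec {α : Type*} [Fintype α] [DecidableEq α] (η : ℝ) (φ : α × Fin 2 → ℂ) :
    dampSnd η (Matrix.vecMulVec φ (star φ)) =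
      Matrix.of fun i k => ∑ j, dampedVec η φ j i * star (dampedVec η φ j k) := by
  have h : ∀ j, ((1 : Matrix α α ℂ) ⊗ₖ kraus η j) *ᵥ φ = dampedVec η φ j := by
    intro j
    ext ⟨a, b⟩
    simp [Matrix.mulVec, dotProduct, Fintype.sum_prod_type, Matrix.kroneckerMap_apply,
      Matrix.one_apply, dampedVec, Finset.sum_ite_eq, ite_mul]
  unfold dampSnd
  ext i k
  simp only [Matrix.mul_vecMulVec, Matrix.vecMulVec_mul, ← Matrix.star_mulVec, h]
  simp [Matrix.sum_apply, Matrix.vecMulVec_apply]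

/-- Qubit matrix with lower right entry completing the trace to one. -/
def qubit (q : ℝ) (c : ℂ) : Matrix (Fin 2) (Fin 2) ℂ := !![(q : ℂ), c; star c, ((1 - q : ℝ) : ℂ)]

lemma isHermitian_smul_qubit (t q : ℝ) (c : ℂ) : ((t : ℂ) • qubit q c).IsHermitian := by
  ext i j
  fin_cases i <;> fin_cases j <;> simp [qubit]

lemma vnEntropy_smul_qubit (t q : ℝ) (c : ℂ) :
    vnEntropy ((t : ℂ) • qubit q c) =
      (Real.negMulLog t + t * detEntropy (q * (1 - q) - ‖c‖ ^ 2)) / Real.log 2 := by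
  refine vnEntropy_fin_two (isHermitian_smul_qubit t q c) ?_ ?_ ?_
  · linarith [mul_one_sub_le_quarter q, sq_nonneg ‖c‖]
  · simp [qubit, Matrix.trace_fin_two]
    ring
  · have h : c * (starRingEnd ℂ) c = (‖c‖ : ℂ) ^ 2 := Complex.mul_conj' c
    simp [qubit, Matrix.det_fin_two]
    linear_combination -(t : ℂ) ^ 2 * h

lemma vnEntropy_qubit (q : ℝ) (c : ℂ) :
    vnEntropy (qubit q c) = detEntropy (q * (1 - q) - ‖c‖ ^ 2) / Real.log 2 := by
  simpa using vnEntropy_smul_qubit 1 q c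

/-! ### Entropies of the ensemble state. -/

namespace Ensemble

variable {n d : ℕ} (e : Ensemble n d)

/-- The population of `|0⟩` in the reduced qubit state of a letter. -/
noncomputable def population (x : Fin n) : ℝ := ∑ a, ‖e.vec x (a, 0)‖ ^ 2

/-- The off-diagonal entry of the reduced qubit state of a letter. -/
noncomputable def coherence (x : Fin n) : ℂ := ∑ a, e.vec x (a, 0) * star (e.vec x (a, 1))

lemma sum_norm_sq_snd (x : Fin n) : ∑ a, ‖e.vec x (a, 1)‖ ^ 2 = 1 - e.population x := by
  have := e.vec_norm x
  rw [Fintype.sum_prod_type] at this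
  simp only [Fin.sum_univ_two, Finset.sum_add_distrib] at this
  rw [population]
  linarith

/-- Cauchy–Schwarz over the reference system; this is positivity of the reduced qubit state. -/
lemma norm_coherence_sq_le (x : Fin n) :
    ‖e.coherence x‖ ^ 2 ≤ e.population x * (1 - e.population x) := by
  rw [← e.sum_norm_sq_snd x, population]
  have h1 : ‖e.coherence x‖ ≤ ∑ a, ‖e.vec x (a, 0)‖ * ‖e.vec x (a, 1)‖ :=
    (norm_sum_le _ _).trans (Finset.sum_le_sum fun a _ => by rw [norm_mul, norm_star])
  exact (pow_le_pow_left₀ (norm_nonneg _) h1 2).trans (Finset.sum_mul_sq_le_sq_mul_sq _ _ _)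

/-- The purification of `ρ_{XAB}`, as a matrix whose columns are indexed by letters and Kraus
operators. -/
noncomputable def purification (η : ℝ) :
    Matrix (Fin n × Fin d × Fin 2) (Fin n × Fin 2) ℂ :=
  Matrix.of fun i j =>
    if i.1 = j.1 then (√(e.prob i.1) : ℂ) * dampedVec η (e.vec i.1) j.2 i.2 else 0

lemma stateXAB_eq_blockSum (η : ℝ) : e.stateXAB η = blockSum fun x =>
    (e.prob x : ℂ) • Matrix.of fun i k =>
      ∑ j, dampedVec η (e.vec x) j i * star (dampedVec η (e.vec x) j k) := by
  ext ⟨x, i⟩ ⟨y, k⟩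
  simp only [stateXAB, dampSnd_vecMulVec, Matrix.sum_apply, Matrix.smul_apply,
    Matrix.kroneckerMap_apply, blockSum, Matrix.of_apply, Matrix.single_apply]
  by_cases h : x = y
  · subst h
    simp
  · rw [if_neg h]
    refine Finset.sum_eq_zero fun z _ => ?_
    rw [if_neg (by rintro ⟨rfl, rfl⟩; exact h rfl)]
    simp

lemma ofReal_sqrt_mul_self {p : ℝ} (hp : 0 ≤ p) : (√p : ℂ) * (√p : ℂ) = p := by
  rw [← Complex.ofReal_mul, Real.mul_self_sqrt hp]

lemma stateXAB_eq_purification (η : ℝ) :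
    e.stateXAB η = e.purification η * (e.purification η)ᴴ := by
  rw [stateXAB_eq_blockSum]
  ext ⟨x, i⟩ ⟨y, k⟩
  simp only [Matrix.mul_apply, Matrix.conjTranspose_apply, Fintype.sum_prod_type, purification,
    Matrix.of_apply, blockSum]
  by_cases h : x = y
  · subst h
    rw [if_pos rfl, Finset.sum_eq_single x (fun z _ hz => by simp [Ne.symm hz]) (by simp)]
    simp only [Matrix.smul_apply, Matrix.of_apply, smul_eq_mul, Finset.mul_sum]
    refine Finset.sum_congr rfl fun j _ => ?_
    rw [← ofReal_sqrt_mul_self (e.prob_nonneg x)]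
    simp
    ring
  · rw [if_neg h]
    refine (Finset.sum_eq_zero fun z _ => Finset.sum_eq_zero fun j _ => ?_).symm
    by_cases hz : x = z
    · subst hz; simp [Ne.symm h]
    · simp [hz]

lemma sum_mul_star_fst (x : Fin n) :
    ∑ a, e.vec x (a, 0) * star (e.vec x (a, 0)) = (e.population x : ℂ) := by
  rw [population, Complex.ofReal_sum]
  refine Finset.sum_congr rfl fun a _ => ?_
  rw [Complex.ofReal_pow]
  exact Complex.mul_conj' _

lemma sum_mul_star_snd (x : Fin n) :
    ∑ a, e.vec x (a, 1) * star (e.vec x (a, 1)) = 1 - (e.population x : ℂ) := by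
  rw [← Complex.ofReal_one, ← Complex.ofReal_sub, ← sum_norm_sq_snd, Complex.ofReal_sum]
  refine Finset.sum_congr rfl fun a _ => ?_
  rw [Complex.ofReal_pow]
  exact Complex.mul_conj' _

lemma star_coherence (x : Fin n) :
    star (e.coherence x) = ∑ a, e.vec x (a, 1) * star (e.vec x (a, 0)) := by
  simp [coherence, star_sum, mul_comm]

lemma kraus_apply (η : ℝ) : kraus η 0 0 0 = (√η : ℂ) ∧ kraus η 0 0 1 = 0 ∧ kraus η 0 1 0 = 0 ∧
    kraus η 0 1 1 = 1 ∧ kraus η 1 0 0 = 0 ∧ kraus η 1 0 1 = 0 ∧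
    kraus η 1 1 0 = (√(1 - η) : ℂ) ∧ kraus η 1 1 1 = 0 := by
  simp [kraus]

/-- The blocks are the transposed environment states, indexed by Kraus operators. They are `2 × 2`
whatever the dimension of the reference. -/
lemma gram_purification {η : ℝ} (hη : η ∈ Icc (0 : ℝ) 1) :
    (e.purification η)ᴴ * e.purification η = blockSum fun x => (e.prob x : ℂ) •
      qubit (1 - (1 - η) * e.population x) ((√(1 - η) : ℂ) * e.coherence x) := by
  obtain ⟨k1, k2, k3, k4, k5, k6, k7, k8⟩ := kraus_apply η
  have hs0 := ofReal_sqrt_mul_self hη.1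
  have hs1 := ofReal_sqrt_mul_self (sub_nonneg.mpr hη.2)
  push_cast at hs1
  ext ⟨x, j⟩ ⟨y, k⟩
  simp only [Matrix.mul_apply, Matrix.conjTranspose_apply, Fintype.sum_prod_type, purification,
    Matrix.of_apply, blockSum]
  by_cases h : x = y
  · subst h
    have hp := ofReal_sqrt_mul_self (e.prob_nonneg x)
    have h0 := e.sum_mul_star_fst x
    have h1 := e.sum_mul_star_snd x
    have h3 := e.star_coherence x
    have h2 : e.coherence x = ∑ a, e.vec x (a, 0) * star (e.vec x (a, 1)) := rfl
    rw [if_pos rfl, Finset.sum_eq_single x (fun z _ hz => by simp [hz]) (by simp)]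
    simp only [Matrix.smul_apply, smul_eq_mul]
    fin_cases j <;> fin_cases k <;>
      simp only [Fin.zero_eta, Fin.mk_one, dampedVec, Fin.sum_univ_two, if_true, k1, k2, k3, k4,
        k5, k6, k7, k8, qubit, Matrix.cons_val', Matrix.cons_val_zero, Matrix.cons_val_one,
        Matrix.of_apply, Matrix.cons_val_fin_one, zero_mul, zero_add, add_zero, map_mul,
        map_zero, mul_zero, one_mul, Complex.star_def, Complex.conj_ofReal]
    all_goals simp only [Complex.star_def] at h0 h1 h2 h3
    · rw [Finset.sum_add_distrib]
      trans (√(e.prob x) : ℂ) * √(e.prob x) * ((√η : ℂ) * √η *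
        (∑ a, e.vec x (a, 0) * (starRingEnd ℂ) (e.vec x (a, 0))) +
        ∑ a, e.vec x (a, 1) * (starRingEnd ℂ) (e.vec x (a, 1)))
      · simp only [mul_add, Finset.mul_sum]
        congr 1 <;> exact Finset.sum_congr rfl fun a _ => by ring
      · rw [hp, hs0, h0, h1]; push_cast; ring
    · rw [h2, ← hp]
      simp only [Finset.mul_sum]
      exact Finset.sum_congr rfl fun a _ => by ring
    · rw [h3, ← hp]
      simp only [Finset.mul_sum]
      exact Finset.sum_congr rfl fun a _ => by ring
    · trans (√(e.prob x) : ℂ) * √(e.prob x) * ((√(1 - η) : ℂ) * √(1 - η) *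
        (∑ a, e.vec x (a, 0) * (starRingEnd ℂ) (e.vec x (a, 0))))
      · simp only [Finset.mul_sum]
        exact Finset.sum_congr rfl fun a _ => by ring
      · rw [hp, hs1, h0]; push_cast; ring
  · rw [if_neg h]
    refine Finset.sum_eq_zero fun z _ => Finset.sum_eq_zero fun a _ =>
      Finset.sum_eq_zero fun b _ => ?_
    by_cases hz : z = x
    · subst hz; simp [h]
    · simp [hz]

lemma stateXB_eq_blockSum {η : ℝ} (hη : η ∈ Icc (0 : ℝ) 1) :
    e.stateXB η = blockSum fun x => (e.prob x : ℂ) •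
      qubit (η * e.population x) ((√η : ℂ) * e.coherence x) := by
  obtain ⟨k1, k2, k3, k4, k5, k6, k7, k8⟩ := kraus_apply η
  have hs0 := ofReal_sqrt_mul_self hη.1
  have hs1 := ofReal_sqrt_mul_self (sub_nonneg.mpr hη.2)
  push_cast at hs1
  rw [stateXB, stateXAB_eq_blockSum]
  ext ⟨x, j⟩ ⟨y, k⟩
  simp only [traceMid, Matrix.of_apply, blockSum]
  by_cases h : x = y
  · subst h
    have h0 := e.sum_mul_star_fst x
    have h1 := e.sum_mul_star_snd x
    have h3 := e.star_coherence x
    have h2 : e.coherence x = ∑ a, e.vec x (a, 0) * star (e.vec x (a, 1)) := rfl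
    simp only [if_true, Matrix.smul_apply, Matrix.of_apply, smul_eq_mul]
    rw [← Finset.mul_sum]
    congr 1
    fin_cases j <;> fin_cases k <;>
      simp only [Fin.zero_eta, Fin.mk_one, dampedVec, Fin.sum_univ_two, k1, k2, k3, k4,
        k5, k6, k7, k8, qubit, Matrix.cons_val', Matrix.cons_val_zero, Matrix.cons_val_one,
        Matrix.of_apply, Matrix.cons_val_fin_one, zero_mul, zero_add, add_zero, map_mul,
        map_zero, mul_zero, one_mul, Complex.star_def, Complex.conj_ofReal]
    all_goals simp only [Complex.star_def] at h0 h1 h2 h3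
    · trans (√η : ℂ) * √η * (∑ a, e.vec x (a, 0) * (starRingEnd ℂ) (e.vec x (a, 0)))
      · simp only [Finset.mul_sum]
        exact Finset.sum_congr rfl fun a _ => by ring
      · rw [hs0, h0]; push_cast; ring
    · rw [h2]
      simp only [Finset.mul_sum]
      exact Finset.sum_congr rfl fun a _ => by ring
    · rw [h3]
      simp only [Finset.mul_sum]
      exact Finset.sum_congr rfl fun a _ => by ring
    · rw [Finset.sum_add_distrib]
      trans (∑ a, e.vec x (a, 1) * (starRingEnd ℂ) (e.vec x (a, 1))) +
        (√(1 - η) : ℂ) * √(1 - η) *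
          (∑ a, e.vec x (a, 0) * (starRingEnd ℂ) (e.vec x (a, 0)))
      · simp only [Finset.mul_sum]
        congr 1
        exact Finset.sum_congr rfl fun a _ => by ring
      · rw [hs1, h0, h1]; push_cast; ring
  · simp [h]

lemma stateX_eq_diagonal {η : ℝ} (hη : η ∈ Icc (0 : ℝ) 1) :
    e.stateX η = Matrix.diagonal fun x => (e.prob x : ℂ) := by
  rw [stateX, stateXB_eq_blockSum e hη]
  ext x y
  by_cases h : x = y
  · subst h
    simp [traceSnd, blockSum, qubit]
    ring
  · simp [traceSnd, blockSum, h]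

lemma stateB_eq_qubit {η : ℝ} (hη : η ∈ Icc (0 : ℝ) 1) :
    e.stateB η = qubit (η * ∑ x, e.prob x * e.population x)
      ((√η : ℂ) * ∑ x, (e.prob x : ℂ) * e.coherence x) := by
  have hp : ∑ x, (e.prob x : ℂ) = 1 := by rw [← Complex.ofReal_sum, e.prob_sum]; simp
  rw [stateB, stateXB_eq_blockSum e hη]
  ext j k
  fin_cases j <;> fin_cases k <;>
    simp [traceFst, blockSum, qubit, Finset.mul_sum]
  · exact Finset.sum_congr rfl fun a _ => by ring
  · exact Finset.sum_congr rfl fun a _ => by ring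
  · exact Finset.sum_congr rfl fun a _ => by ring
  · simp only [mul_sub, mul_one, Finset.sum_sub_distrib, hp]
    congr 1
    exact Finset.sum_congr rfl fun a _ => by ring

/-- The quantity `q - |c|²` of the reduced qubit state with population `q`, coherence `c`. -/
noncomputable def mixedness (x : Fin n) : ℝ := e.population x - ‖e.coherence x‖ ^ 2

lemma norm_sqrt_mul_sq {η : ℝ} (hη : 0 ≤ η) (c : ℂ) : ‖(√η : ℂ) * c‖ ^ 2 = η * ‖c‖ ^ 2 := by
  rw [norm_mul, mul_pow, Complex.norm_real, Real.norm_eq_abs, sq_abs, Real.sq_sqrt hη]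

lemma vnEntropy_stateXAB {η : ℝ} (hη : η ∈ Icc (0 : ℝ) 1) :
    vnEntropy (e.stateXAB η) = (∑ x, Real.negMulLog (e.prob x) + ∑ x, e.prob x *
      detEntropy ((1 - η) * (e.mixedness x - (1 - η) * e.population x ^ 2))) / Real.log 2 := by
  rw [stateXAB_eq_purification, vnEntropy_mul_conjTranspose_comm, gram_purification e hη,
    vnEntropy_blockSum fun x => isHermitian_smul_qubit _ _ _, ← Finset.sum_add_distrib,
    Finset.sum_div]
  refine Finset.sum_congr rfl fun x _ => ?_
  rw [vnEntropy_smul_qubit, norm_sqrt_mul_sq (sub_nonneg.mpr hη.2), mixedness]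
  congr 4
  ring

lemma vnEntropy_stateXB {η : ℝ} (hη : η ∈ Icc (0 : ℝ) 1) :
    vnEntropy (e.stateXB η) = (∑ x, Real.negMulLog (e.prob x) + ∑ x, e.prob x *
      detEntropy (η * (e.mixedness x - η * e.population x ^ 2))) / Real.log 2 := by
  rw [stateXB_eq_blockSum e hη,
    vnEntropy_blockSum fun x => isHermitian_smul_qubit _ _ _, ← Finset.sum_add_distrib,
    Finset.sum_div]
  refine Finset.sum_congr rfl fun x _ => ?_
  rw [vnEntropy_smul_qubit, norm_sqrt_mul_sq hη.1, mixedness]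
  congr 4
  ring

lemma coherentInfo_eq {η : ℝ} (hη : η ∈ Icc (0 : ℝ) 1) :
    e.coherentInfo η = (∑ x, e.prob x *
      (detEntropy (η * (e.mixedness x - η * e.population x ^ 2)) -
        detEntropy ((1 - η) * (e.mixedness x - (1 - η) * e.population x ^ 2)))) /
      Real.log 2 := by
  rw [coherentInfo, vnEntropy_stateXB e hη, vnEntropy_stateXAB e hη]
  simp only [mul_sub, Finset.sum_sub_distrib]
  ring

/-- The entropies of `BX` cancel, leaving `H(X) + H(B) - H(ABX)`, and `H(X)` cancels the letter
entropy contained in `H(ABX)`. -/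
lemma holevoInfo_add_coherentInfo_eq {η : ℝ} (hη : η ∈ Icc (0 : ℝ) 1) :
    e.holevoInfo η + e.coherentInfo η =
      (detEntropy (η * ((∑ x, e.prob x * e.population x -
          ‖∑ x, (e.prob x : ℂ) * e.coherence x‖ ^ 2) -
          η * (∑ x, e.prob x * e.population x) ^ 2)) -
        ∑ x, e.prob x *
          detEntropy ((1 - η) * (e.mixedness x - (1 - η) * e.population x ^ 2))) /
      Real.log 2 := by
  rw [holevoInfo, coherentInfo, stateX_eq_diagonal e hη, vnEntropy_diagonal,
    stateB_eq_qubit e hη, vnEntropy_qubit, norm_sqrt_mul_sq hη.1, vnEntropy_stateXAB e hη]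
  have h : η * (∑ x, e.prob x * e.population x) * (1 - η * ∑ x, e.prob x * e.population x) -
      η * ‖∑ x, (e.prob x : ℂ) * e.coherence x‖ ^ 2 =
      η * ((∑ x, e.prob x * e.population x - ‖∑ x, (e.prob x : ℂ) * e.coherence x‖ ^ 2) -
          η * (∑ x, e.prob x * e.population x) ^ 2) := by ring
  rw [h]
  ring

lemma population_sq_le_mixedness (x : Fin n) : e.population x ^ 2 ≤ e.mixedness x := by
  have := e.norm_coherence_sq_le x
  rw [mixedness]
  linarith

lemma mixedness_le_population (x : Fin n) : e.mixedness x ≤ e.population x := by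
  rw [mixedness]
  linarith [sq_nonneg ‖e.coherence x‖]

/-- Positivity of the averaged qubit, obtained from the letterwise bound and convexity of the
square, applied to coherences and to populations. -/
lemma norm_sum_coherence_sq_le :
    ‖∑ x, (e.prob x : ℂ) * e.coherence x‖ ^ 2 ≤ (∑ x, e.prob x * e.population x) -
      (∑ x, e.prob x * e.population x) ^ 2 := by
  have hsq : ConvexOn ℝ univ fun x : ℝ => x ^ 2 := even_two.convexOn_pow
  have h1 : ‖∑ x, (e.prob x : ℂ) * e.coherence x‖ ≤ ∑ x, e.prob x * ‖e.coherence x‖ := by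
    refine (norm_sum_le _ _).trans (Finset.sum_le_sum fun x _ => ?_)
    rw [norm_mul, Complex.norm_real, Real.norm_eq_abs, abs_of_nonneg (e.prob_nonneg x)]
  have h2 := hsq.map_sum_le (t := Finset.univ) (w := e.prob) (p := fun x => ‖e.coherence x‖)
    (fun x _ => e.prob_nonneg x) e.prob_sum fun x _ => mem_univ _
  have h3 := hsq.map_sum_le (t := Finset.univ) (w := e.prob) (p := e.population)
    (fun x _ => e.prob_nonneg x) e.prob_sum fun x _ => mem_univ _
  simp only [smul_eq_mul] at h2 h3
  have h4 : ∑ x, e.prob x * ‖e.coherence x‖ ^ 2 ≤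
      ∑ x, (e.prob x * e.population x - e.prob x * e.population x ^ 2) :=
    Finset.sum_le_sum fun x _ => by
      have := mul_le_mul_of_nonneg_left (e.norm_coherence_sq_le x) (e.prob_nonneg x)
      linarith
  rw [Finset.sum_sub_distrib] at h4
  have h5 := pow_le_pow_left₀ (norm_nonneg _) h1 2
  linarith

end Ensemble

/-! ### The function `g` and the ensembles attaining the bounds. -/

lemma h2_eq (y : ℝ) : h2 y = Real.binEntropy y / Real.log 2 := by
  rw [h2, Real.binEntropy_eq_negMulLog_add_negMulLog_one_sub]
  simp only [Real.negMulLog, Real.logb]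
  ring

lemma g_eq (q z ν : ℝ) :
    g q z ν = detEntropy (z * ((q - ν ^ 2 * (q * (1 - q))) - z * q ^ 2)) / Real.log 2 := by
  rw [g, h2_eq, detEntropy]
  congr 5
  ring

lemma exists_sq_mul_eq {p M : ℝ} (h1 : p ^ 2 ≤ M) (h2 : M ≤ p) :
    ∃ ν ∈ Icc (0 : ℝ) 1, p - ν ^ 2 * (p * (1 - p)) = M := by
  have hp := mem_Icc_of_sq_le h1 h2
  rcases (mul_nonneg hp.1 (sub_nonneg.mpr hp.2)).eq_or_lt with h | h
  -- If `p(1-p) = 0` then `p² = p` pins `M` to `p`, and any `ν` would do.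
  · exact ⟨0, by simp, by linarith⟩
  · have h0 : 0 ≤ (p - M) / (p * (1 - p)) := div_nonneg (by linarith) h.le
    refine ⟨√((p - M) / (p * (1 - p))), ⟨Real.sqrt_nonneg _, ?_⟩, ?_⟩
    · rw [Real.sqrt_le_one, div_le_one h]; linarith
    · rw [Real.sq_sqrt h0, div_mul_cancel₀ _ h.ne']; ring

/-- The purification `√q |0⟩|0⟩ + √(1-q) (s |0⟩ + √(1-s²) |1⟩)|1⟩`. -/
noncomputable def letterVec (q s : ℝ) : Fin 2 × Fin 2 → ℂ := fun i =>
  !![(√q : ℂ), (s * √(1 - q) : ℂ); 0, (√(1 - s ^ 2) * √(1 - q) : ℂ)] i.1 i.2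

lemma sum_norm_letterVec {q s : ℝ} (hq : q ∈ Icc (0 : ℝ) 1) (hs : s ^ 2 ≤ 1) :
    ∑ i, ‖letterVec q s i‖ ^ 2 = 1 := by
  simp [letterVec, Fintype.sum_prod_type, mul_pow, Real.sq_sqrt hq.1,
    Real.sq_sqrt (sub_nonneg.mpr hq.2), Real.sq_sqrt (sub_nonneg.mpr hs)]
  ring

/-- The ensemble in which each of two letters is sent with both signs of its coherence. -/
noncomputable def twoLetterEnsemble (p q ν : Fin 2 → ℝ) (hp : p 0 ∈ Icc (0 : ℝ) 1)
    (hp1 : p 1 = 1 - p 0) (hq : ∀ x, q x ∈ Icc (0 : ℝ) 1) (hν : ∀ x, ν x ∈ Icc (0 : ℝ) 1) :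
    Ensemble 4 2 where
  prob := ![p 0 / 2, p 0 / 2, p 1 / 2, p 1 / 2]
  prob_nonneg := by
    have h0 := hp.1
    have h1 := hp.2
    intro x
    fin_cases x <;> simp <;> linarith
  prob_sum := by
    simp [Fin.sum_univ_four]
    linarith
  vec := ![letterVec (q 0) (ν 0), letterVec (q 0) (-ν 0), letterVec (q 1) (ν 1),
    letterVec (q 1) (-ν 1)]
  vec_norm := by
    have h0 : ∀ x, ν x ^ 2 ≤ 1 := fun x => pow_le_one₀ (hν x).1 (hν x).2
    intro x
    fin_cases x
    · exact sum_norm_letterVec (hq 0) (h0 0)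
    · exact sum_norm_letterVec (hq 0) (by rw [neg_sq]; exact h0 0)
    · exact sum_norm_letterVec (hq 1) (h0 1)
    · exact sum_norm_letterVec (hq 1) (by rw [neg_sq]; exact h0 1)

section

variable {n : ℕ} {e : Ensemble n 2} {x : Fin n} {q s : ℝ}

lemma population_of_letterVec (h : e.vec x = letterVec q s) (hq : 0 ≤ q) :
    e.population x = q := by
  simp [Ensemble.population, h, letterVec, Real.sq_sqrt hq]

lemma coherence_of_letterVec (h : e.vec x = letterVec q s) :
    e.coherence x = (√q * (s * √(1 - q)) : ℝ) := by
  simp [Ensemble.coherence, h, letterVec]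

lemma mixedness_of_letterVec (h : e.vec x = letterVec q s) (hq : q ∈ Icc (0 : ℝ) 1) :
    e.mixedness x = q - s ^ 2 * (q * (1 - q)) := by
  rw [Ensemble.mixedness, population_of_letterVec h hq.1, coherence_of_letterVec h,
    Complex.norm_real, Real.norm_eq_abs, sq_abs, mul_pow, mul_pow, Real.sq_sqrt hq.1,
    Real.sq_sqrt (sub_nonneg.mpr hq.2)]
  ring

end

end AmplitudeDamping

open AmplitudeDamping in
theorem theorem1 (η : ℝ) (hη : η ∈ Set.Icc (0 : ℝ) 1) :
    AmplitudeDamping.tradeoffRegion η =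
      {r : ℝ × ℝ | ∃ p q ν : Fin 2 → ℝ,
        p 0 ∈ Set.Icc (0 : ℝ) 1 ∧ p 1 = 1 - p 0 ∧
        (∀ x, q x ∈ Set.Icc (0 : ℝ) 1) ∧ (∀ x, ν x ∈ Set.Icc (0 : ℝ) 1) ∧
        r ∈ AmplitudeDamping.ratePolyhedron
          (∑ x, p x * (AmplitudeDamping.g (q x) η (ν x)
            - AmplitudeDamping.g (q x) (1 - η) (ν x)))
          (AmplitudeDamping.h2 (η * ∑ x, p x * q x)
            - ∑ x, p x * AmplitudeDamping.g (q x) (1 - η) (ν x))} := by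
  have hlog : 0 < Real.log 2 := Real.log_pos one_lt_two
  ext r
  simp only [tradeoffRegion, Set.mem_iUnion, Set.mem_ofPred_eq]
  constructor
  · rintro ⟨n, d, e, hQ, hCQ⟩
    rw [e.coherentInfo_eq hη] at hQ
    rw [e.holevoInfo_add_coherentInfo_eq hη] at hCQ
    obtain ⟨p, M, hp, h1, h2, hA, hB⟩ := exists_dominating_letter hη e.prob_nonneg e.prob_sum
      e.population_sq_le_mixedness e.mixedness_le_population
    obtain ⟨ν, hν, hM⟩ := exists_sq_mul_eq h1 h2
    have hpm := mem_Icc_of_sq_le h1 h2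
    have hpin := e.norm_sum_coherence_sq_le
    rw [← hp] at hCQ hpin
    -- The dominating letter gets all the weight; the second letter is a dummy.
    refine ⟨![1, 0], fun _ => p, fun _ => ν, by simp, by simp, fun _ => hpm, fun _ => hν, ?_, ?_⟩
    · refine hQ.trans ?_
      simp only [Fin.sum_univ_two, Matrix.cons_val_zero, Matrix.cons_val_one, one_mul, zero_mul,
        add_zero, g_eq, hM]
      rw [← sub_div]
      exact div_le_div_of_nonneg_right hA hlog.le
    · refine hCQ.trans ?_
      simp only [Fin.sum_univ_two, Matrix.cons_val_zero, Matrix.cons_val_one, one_mul, zero_mul,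
        add_zero, g_eq, hM, h2_eq]
      rw [← sub_div]
      -- The mean output has population `ηp` and possibly some coherence; without coherence its
      -- entropy would be `h₂(ηp)`, which is no smaller.
      have hle := detEntropy_le_binEntropy hη
        (m := p - ‖∑ x, (e.prob x : ℂ) * e.coherence x‖ ^ 2) (q := p)
        (by linarith) (by linarith [sq_nonneg ‖∑ x, (e.prob x : ℂ) * e.coherence x‖])
      exact div_le_div_of_nonneg_right (sub_le_sub hle hB) hlog.le
  · rintro ⟨p, q, ν, hp, hp1, hq, hν, hQ, hCQ⟩
    set e := twoLetterEnsemble p q ν hp hp1 hq hν with he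
    have v0 : e.vec 0 = letterVec (q 0) (ν 0) := rfl
    have v1 : e.vec 1 = letterVec (q 0) (-ν 0) := rfl
    have v2 : e.vec 2 = letterVec (q 1) (ν 1) := rfl
    have v3 : e.vec 3 = letterVec (q 1) (-ν 1) := rfl
    have w0 : e.prob 0 = p 0 / 2 := rfl
    have w1 : e.prob 1 = p 0 / 2 := rfl
    have w2 : e.prob 2 = p 1 / 2 := rfl
    have w3 : e.prob 3 = p 1 / 2 := rfl
    have hmean : ∑ x, e.prob x * e.population x = ∑ x, p x * q x := by
      rw [Fin.sum_univ_four, Fin.sum_univ_two, population_of_letterVec v0 (hq 0).1,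
        population_of_letterVec v1 (hq 0).1, population_of_letterVec v2 (hq 1).1,
        population_of_letterVec v3 (hq 1).1, w0, w1, w2, w3]
      ring
    -- The two signs of each letter carry equal weight, so their coherences cancel.
    have hcoh : ∑ x, (e.prob x : ℂ) * e.coherence x = 0 := by
      rw [Fin.sum_univ_four, coherence_of_letterVec v0, coherence_of_letterVec v1,
        coherence_of_letterVec v2, coherence_of_letterVec v3, w0, w1, w2, w3]
      push_cast
      ring
    refine ⟨4, 2, e, ?_, ?_⟩
    · refine hQ.trans_eq ?_
      rw [e.coherentInfo_eq hη, Fin.sum_univ_four, Fin.sum_univ_two,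
        population_of_letterVec v0 (hq 0).1,
        population_of_letterVec v1 (hq 0).1, population_of_letterVec v2 (hq 1).1,
        population_of_letterVec v3 (hq 1).1, mixedness_of_letterVec v0 (hq 0),
        mixedness_of_letterVec v1 (hq 0), mixedness_of_letterVec v2 (hq 1),
        mixedness_of_letterVec v3 (hq 1), w0, w1, w2, w3]
      simp only [g_eq, neg_sq]
      ring
    · refine hCQ.trans_eq ?_
      rw [e.holevoInfo_add_coherentInfo_eq hη, hmean, hcoh, h2_eq, ← detEntropy_mul_one_sub,
        Fin.sum_univ_four, population_of_letterVec v0 (hq 0).1,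
        population_of_letterVec v1 (hq 0).1, population_of_letterVec v2 (hq 1).1,
        population_of_letterVec v3 (hq 1).1, mixedness_of_letterVec v0 (hq 0),
        mixedness_of_letterVec v1 (hq 0), mixedness_of_letterVec v2 (hq 1),
        mixedness_of_letterVec v3 (hq 1), w0, w1, w2, w3]
      have harg : ∀ s : ℝ, η * ((s - ‖(0 : ℂ)‖ ^ 2) - η * s ^ 2) = η * s * (1 - η * s) := by
        intro s
        rw [norm_zero]
        ring
      rw [harg]
      simp only [g_eq, neg_sq, Fin.sum_univ_two]
      ring
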